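/- Graphs are finite, undirected, simple and unlabelled. For a monadic second-order formula $\varphi(x_1,x_2;y_1,\dots,y_\ell)$ in the vocabulary $\{E\}$ of graphs, with free individual variables among those displayed and no free set variables, a graph $G$, a sequence $\mathbf a=(\vec a_1,\dots,\vec a_m)\in (V(G)^2)^m$ and $\sigma\colon\{1,\dots,m\}\to\{+1,-1\}$, call $(G,\mathbf a,\sigma)$ *$\varphi$-consistent* if there is $\vec w\in V(G)^\ell$ such that for all $i\in\{1,\dots,m\}$: $G\models\varphi(\vec a_i;\vec w)$ if and only if $\sigma(i)=+1$. The *clique-width* of $G$ is the least $c$ such that $G$ (up to isomorphism, forgetting labels) can be built with $c$ labels, each vertex carrying a set of labels, from single vertices (with arbitrary label sets) by disjoint union, by adding all edges between distinct vertices $v,w$ such that $v$ has label $P$ and $w$ has label $Q$ (for labels $P\ne Q$), by replacing a label $P$ by a label $Q\neq P$, and by deleting a label. **Theorem.** There is a $q\in\mathbb N$ such that the following parameterized problem is $\mathrm{W}[1]$-hard (under fpt many-one reductions). *Input:* $\ell\in\mathbb N$, a graph $G$ of clique-width at most $2$, a sequence $\mathbf a\in (V(G)^2)^m$, a function $\sigma\colon\{1,\dots,m\}\to\{+1,-1\}$,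 and a monadic second-order formula $\varphi(x_1,x_2;y_1,\dots,y_\ell)$ of quantifier rank at most $q$. *Parameter:* $\ell$. *Question:* is $(G,\mathbf a,\sigma)$ $\varphi$-consistent? For the same $q$ there is moreover a computable function $h\colon\mathbb N\to\mathbb N$ such that the problem remains $\mathrm{W}[1]$-hard when restricted to inputs in which $G$ is in addition a forest and $\varphi$ has encoding length at most $h(\ell)$. -/

import Mathlib

/-! ### Data, programs and running time

Inputs are binary trees without labels (S-expressions over the single atom `leaf`), and algorithms
are programs of a small WHILE language on these trees, in which the evaluation of every construct
is charged the full size of its argument.  Words over a finite alphabet, numbers, lists, graphs and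
formulas are trees in an obvious way, and the model is polynomially equivalent to Turing
machines. -/

/-- Unlabelled binary trees. -/
inductive BTree : Type
  | leaf : BTree
  | node : BTree → BTree → BTree

namespace BTree

/-- The number of nodes, counting the leaves. -/
def size : BTree → ℕ
  | leaf => 1
  | node l r => l.size + r.size + 1

/-- The left subtree (`leaf` has the left subtree `leaf`). -/
def left : BTree → BTree
  | leaf => leaf
  | node l _ => l

/-- The right subtree (`leaf` has the right subtree `leaf`). -/
def right : BTree → BTree
  | leaf => leaf
  | node _ r => r

/-- The number of steps to the right that lead from the root to a leaf: the length of the list that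
the tree encodes, and the number that it encodes if it encodes one. -/
def spine : BTree → ℕ
  | leaf => 0
  | node _ r => r.spine + 1

/-- Numbers are encoded in unary. -/
def ofNat : ℕ → BTree
  | 0 => leaf
  | n + 1 => node leaf (ofNat n)

/-- The encoding of a list of trees. -/
def ofList : List BTree → BTree
  | [] => leaf
  | x :: xs => node x (ofList xs)

/-- The encoding of a truth value. -/
def ofBool : Bool → BTree
  | false => leaf
  | true => node leaf leaf

/-- The encoding of a tuple of elements of `{0, …, n - 1}`. -/
def ofTuple {k n : ℕ} (v : Fin k → Fin n) : BTree :=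
  ofList (List.ofFn fun i => ofNat (v i))

end BTree

/-- Programs.  Each one computes a partial function from trees to trees. -/
inductive Prog : Type
  /-- return the argument -/
  | skip : Prog
  /-- return `leaf` -/
  | nil : Prog
  /-- return the left subtree of the argument -/
  | left : Prog
  /-- return the right subtree of the argument -/
  | right : Prog
  /-- apply both programs to the argument and join the two results by a new root -/
  | pair : Prog → Prog → Prog
  /-- apply the first program, and then the second one to the result -/
  | seq : Prog → Prog → Prog
  /-- `cond c p q`: if `c` returns a tree other than `leaf`, apply `p`, otherwise apply `q` -/
  | cond : Prog → Prog → Prog → Prog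
  /-- `loop c p`: as long as `c` returns a tree other than `leaf`, replace the argument by the
  result of `p` -/
  | loop : Prog → Prog → Prog

/-- `Runs p x y t`: on input `x`, the program `p` halts with output `y` after exactly `t` steps.
The evaluation of a construct on `x` takes `x.size` steps plus the time for its parts, so a program
cannot produce an output, or any intermediate value, larger than its running time. -/
inductive Runs : Prog → BTree → BTree → ℕ → Prop
  | skip (x : BTree) : Runs .skip x x x.size
  | nil (x : BTree) : Runs .nil x .leaf x.size
  | left (x : BTree) : Runs .left x x.left x.size
  | right (x : BTree) : Runs .right x x.right x.size
  | pair {p q : Prog} {x y z : BTree} {s t : ℕ} (hp : Runs p x y s) (hq : Runs q x z t) :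
      Runs (.pair p q) x (.node y z) (s + t + x.size)
  | seq {p q : Prog} {x y z : BTree} {s t : ℕ} (hp : Runs p x y s) (hq : Runs q y z t) :
      Runs (.seq p q) x z (s + t + x.size)
  | cond_true {c p q : Prog} {x b y : BTree} {s t : ℕ} (hc : Runs c x b s) (hb : b ≠ .leaf)
      (hp : Runs p x y t) : Runs (.cond c p q) x y (s + t + x.size)
  | cond_false {c p q : Prog} {x y : BTree} {s t : ℕ} (hc : Runs c x .leaf s)
      (hq : Runs q x y t) : Runs (.cond c p q) x y (s + t + x.size)
  | loop_stop {c p : Prog} {x : BTree} {s : ℕ} (hc : Runs c x .leaf s) :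
      Runs (.loop c p) x x (s + x.size)
  | loop_step {c p : Prog} {x b y z : BTree} {s t u : ℕ} (hc : Runs c x b s) (hb : b ≠ .leaf)
      (hp : Runs p x y t) (hl : Runs (.loop c p) y z u) :
      Runs (.loop c p) x z (s + t + u + x.size)

/-! ### Parameterized problems, fpt reductions -/

/-- A parameterized problem: the set of yes-instances and the parameterization.  Trees that do not
encode an instance are no-instances. -/
structure ParamProblem : Type where
  yes : Set BTree
  param : BTree → ℕ

/-- The existence of an fpt (many-one) reduction: a program that maps instances to equivalent
instances, runs in time `f (κ x) * P |x|` with `f` computable and `P` a polynomial, and increases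
the parameter at most by a computable function `g`. -/
def FptReducible (A B : ParamProblem) : Prop :=
  ∃ (p : Prog) (f g : ℕ → ℕ) (P : Polynomial ℕ), Computable f ∧ Computable g ∧
    ∀ x : BTree, ∃ (y : BTree) (t : ℕ), Runs p x y t ∧
      t ≤ f (A.param x) * P.eval x.size ∧
      (x ∈ A.yes ↔ y ∈ B.yes) ∧
      B.param y ≤ g (A.param x)

/-! ### The class W[1]

W[1] is the closure under fpt reductions of the weighted definability problems for universal
first-order formulas with one free relation variable. -/

/-- A finite relational vocabulary. -/
structure Vocab : Type where
  num : ℕ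
  arity : Fin num → ℕ

/-- A structure over the vocabulary `τ` with universe `U`. -/
structure RelStr (τ : Vocab) (U : Type) : Type where
  rel : (R : Fin τ.num) → Set (Fin (τ.arity R) → U)

/-- Quantifier-free first-order formulas over `τ` with an additional relation variable `X` of arity
`s`, in the individual variables `x_0, …, x_{d-1}`. -/
inductive QFFormula (τ : Vocab) (s d : ℕ) : Type
  | eq (i j : Fin d) : QFFormula τ s d
  | rel (R : Fin τ.num) (v : Fin (τ.arity R) → Fin d) : QFFormula τ s d
  | var (v : Fin s → Fin d) : QFFormula τ s d
  | neg (ψ : QFFormula τ s d) : QFFormula τ s d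
  | conj (ψ χ : QFFormula τ s d) : QFFormula τ s d
  | disj (ψ χ : QFFormula τ s d) : QFFormula τ s d

/-- Satisfaction of a quantifier-free formula, with `X` interpreted by `S`. -/
def QFFormula.Holds {τ : Vocab} {s d : ℕ} {U : Type} (A : RelStr τ U) (S : Set (Fin s → U))
    (a : Fin d → U) : QFFormula τ s d → Prop
  | .eq i j => a i = a j
  | .rel R v => (fun i => a (v i)) ∈ A.rel R
  | .var v => (fun i => a (v i)) ∈ S
  | .neg ψ => ¬ ψ.Holds A S a
  | .conj ψ χ => ψ.Holds A S a ∧ χ.Holds A S a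
  | .disj ψ χ => ψ.Holds A S a ∨ χ.Holds A S a

/-- The weighted definability problem of the universal formula `∀ x_0 … x_{d-1}, ψ`: given `k` and
a finite structure (with universe `{0, …, n - 1}`, every relation given by a list of its tuples),
decide whether there is a relation `S` of exactly `k` tuples that satisfies the formula.  The
parameter is `k`. -/
def weightedDefinability {τ : Vocab} {s d : ℕ} (ψ : QFFormula τ s d) : ParamProblem where
  yes := {x | ∃ (k n : ℕ) (A : RelStr τ (Fin n))
      (L : (R : Fin τ.num) → List (Fin (τ.arity R) → Fin n)),
      0 < n ∧ (∀ R t, t ∈ L R ↔ t ∈ A.rel R) ∧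
      x = .node (.ofNat k) (.node (.ofNat n)
        (.ofList (List.ofFn fun R => .ofList ((L R).map .ofTuple)))) ∧
      ∃ S : Finset (Fin s → Fin n), S.card = k ∧ ∀ a : Fin d → Fin n, ψ.Holds A (S : Set _) a}
  param x := x.left.spine

/-- The complexity class W[1]. -/
def W1 : Set ParamProblem :=
  {A | ∃ (τ : Vocab) (s d : ℕ) (ψ : QFFormula τ s d), FptReducible A (weightedDefinability ψ)}

/-- W[1]-hardness (under fpt reductions). -/
def W1Hard (B : ParamProblem) : Prop :=
  ∀ A ∈ W1, FptReducible A B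

/-! ### Clique-width -/

open Classical in
/-- `Described G lab`: the graph `G` whose vertices carry labels from `Λ`, where `lab P` is the set
of vertices with label `P`, is described by a `Λ`-expression.  The derivations are the expressions.
A vertex may have several labels, or none, and a graph in which a label does not occur is not
distinguished from one whose label set lacks this label. -/
inductive Described {Λ : Type} : {V : Type} → SimpleGraph V → (Λ → Set V) → Prop
  /-- a single vertex, with the labels in `S` -/
  | base (S : Set Λ) : Described (⊥ : SimpleGraph Unit) (fun P => {_v | P ∈ S})
  /-- disjoint union -/
  | union {V W : Type} {G : SimpleGraph V} {H : SimpleGraph W} {lab : Λ → Set V} {lab' : Λ → Set W}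
      (hG : Described G lab) (hH : Described H lab') :
      Described (G.sum H) (fun P => Sum.inl '' lab P ∪ Sum.inr '' lab' P)
  /-- add all edges between distinct vertices `v` with label `P` and `w` with label `Q` -/
  | addEdges {V : Type} {G : SimpleGraph V} {lab : Λ → Set V} (P Q : Λ) (hPQ : P ≠ Q)
      (hG : Described G lab) :
      Described (G ⊔ SimpleGraph.fromRel (fun v w => v ∈ lab P ∧ w ∈ lab Q)) lab
  /-- replace the label `P` by the label `Q` -/
  | relabel {V : Type} {G : SimpleGraph V} {lab : Λ → Set V} (P Q : Λ) (hPQ : P ≠ Q)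
      (hG : Described G lab) :
      Described G (fun R => if R = P then ∅ else if R = Q then lab Q ∪ lab P else lab R)
  /-- delete the label `P` -/
  | delete {V : Type} {G : SimpleGraph V} {lab : Λ → Set V} (P : Λ) (hG : Described G lab) :
      Described G (fun R => if R = P then ∅ else lab R)

/-- The clique-width of an unlabelled graph: the least `c` such that the graph is, up to
isomorphism, described by an expression over `c` labels (`⊤` for the graph without vertices). -/
noncomputable def cliqueWidth {V : Type} (G : SimpleGraph V) : ℕ∞ :=
  ⨅ (c : ℕ) (_ : ∃ (W : Type) (H : SimpleGraph W) (lab : Fin c → Set W),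
    Described H lab ∧ Nonempty (G ≃g H)), (c : ℕ∞)

/-! ### Monadic second-order logic on graphs -/

/-- `MSO a b`: monadic second-order formulas in the vocabulary of graphs, with free individual
variables among the variables `0, …, a - 1` and free set variables among `0, …, b - 1`.  A
quantifier binds the variable of the next higher index. -/
inductive MSO : ℕ → ℕ → Type
  | eq {a b : ℕ} (x y : Fin a) : MSO a b
  | adj {a b : ℕ} (x y : Fin a) : MSO a b
  | mem {a b : ℕ} (x : Fin a) (X : Fin b) : MSO a b
  | neg {a b : ℕ} (φ : MSO a b) : MSO a b
  | conj {a b : ℕ} (φ ψ : MSO a b) : MSO a b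
  | disj {a b : ℕ} (φ ψ : MSO a b) : MSO a b
  | ex {a b : ℕ} (φ : MSO (a + 1) b) : MSO a b
  | all {a b : ℕ} (φ : MSO (a + 1) b) : MSO a b
  | exSet {a b : ℕ} (φ : MSO a (b + 1)) : MSO a b
  | allSet {a b : ℕ} (φ : MSO a (b + 1)) : MSO a b

namespace MSO

/-- The quantifier rank (nesting depth of quantifiers of both kinds). -/
def qr : {a b : ℕ} → MSO a b → ℕ
  | _, _, eq _ _ => 0
  | _, _, adj _ _ => 0
  | _, _, mem _ _ => 0
  | _, _, neg φ => φ.qr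
  | _, _, conj φ ψ => max φ.qr ψ.qr
  | _, _, disj φ ψ => max φ.qr ψ.qr
  | _, _, ex φ => φ.qr + 1
  | _, _, all φ => φ.qr + 1
  | _, _, exSet φ => φ.qr + 1
  | _, _, allSet φ => φ.qr + 1

/-- Satisfaction in a graph. -/
def Holds {V : Type} (G : SimpleGraph V) :
    {a b : ℕ} → MSO a b → (Fin a → V) → (Fin b → Set V) → Prop
  | _, _, eq x y, v, _ => v x = v y
  | _, _, adj x y, v, _ => G.Adj (v x) (v y)
  | _, _, mem x X, v, W => v x ∈ W X
  | _, _, neg φ, v, W => ¬ φ.Holds G v W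
  | _, _, conj φ ψ, v, W => φ.Holds G v W ∧ ψ.Holds G v W
  | _, _, disj φ ψ, v, W => φ.Holds G v W ∨ ψ.Holds G v W
  | _, _, ex φ, v, W => ∃ u : V, φ.Holds G (Fin.snoc v u) W
  | _, _, all φ, v, W => ∀ u : V, φ.Holds G (Fin.snoc v u) W
  | _, _, exSet φ, v, W => ∃ U : Set V, φ.Holds G v (Fin.snoc W U)
  | _, _, allSet φ, v, W => ∀ U : Set V, φ.Holds G v (Fin.snoc W U)

/-- The encoding of a formula by a tree: a number for the outermost symbol, and the operands. -/
def encode : {a b : ℕ} → MSO a b → BTree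
  | _, _, eq x y => .node (.ofNat 0) (.node (.ofNat x) (.ofNat y))
  | _, _, adj x y => .node (.ofNat 1) (.node (.ofNat x) (.ofNat y))
  | _, _, mem x X => .node (.ofNat 2) (.node (.ofNat x) (.ofNat X))
  | _, _, neg φ => .node (.ofNat 3) φ.encode
  | _, _, conj φ ψ => .node (.ofNat 4) (.node φ.encode ψ.encode)
  | _, _, disj φ ψ => .node (.ofNat 5) (.node φ.encode ψ.encode)
  | _, _, ex φ => .node (.ofNat 6) φ.encode
  | _, _, all φ => .node (.ofNat 7) φ.encode
  | _, _, exSet φ => .node (.ofNat 8) φ.encode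
  | _, _, allSet φ => .node (.ofNat 9) φ.encode

end MSO

/-! ### The consistency problem -/

/-- Let `φ` be a formula with `k` instance variables, followed by `l` parameter variables.  The
labeled examples `(a i, σ i)`, where `true` stands for `+1` and `false` for `-1`, are consistent
with `φ` on `G` if some parameter setting `w` makes `φ` true exactly at the positive examples. -/
def IsConsistent {V : Type} (G : SimpleGraph V) {k l m : ℕ} (φ : MSO (k + l) 0)
    (a : Fin m → Fin k → V) (σ : Fin m → Bool) : Prop :=
  ∃ w : Fin l → V, ∀ i : Fin m, φ.Holds G (Fin.append (a i) w) Fin.elim0 ↔ σ i = true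

/-- The encoding of an instance of the consistency problem, for a graph with vertex set
`{0, …, n - 1}` and the list `E` of edges. -/
def encodeInstance {n k l m : ℕ} (E : List (Fin n × Fin n)) (a : Fin m → Fin k → Fin n)
    (σ : Fin m → Bool) (φ : MSO (k + l) 0) : BTree :=
  .node (.ofNat l) (.node (.ofNat n) (.node
    (.ofList (E.map fun e => .node (.ofNat e.1) (.ofNat e.2))) (.node
      (.ofList (List.ofFn fun i => .node (.ofTuple (a i)) (.ofBool (σ i))))
      φ.encode)))

/-- The consistency problem for `k`-dimensional examples and formulas of quantifier rank at most
`q`: given `l`, a graph `G`, examples `a` with signs `σ`, and a formula `φ`, decide whether the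
examples are consistent with `φ` on `G`.  The parameter is `l`.  The admissible instances are those
with `C G φ`. -/
def consistencyProblem (k q : ℕ)
    (C : {n l : ℕ} → SimpleGraph (Fin n) → MSO (k + l) 0 → Prop) : ParamProblem where
  yes := {x | ∃ (n l m : ℕ) (G : SimpleGraph (Fin n)) (E : List (Fin n × Fin n))
      (a : Fin m → Fin k → Fin n) (σ : Fin m → Bool) (φ : MSO (k + l) 0),
      (∀ u v, G.Adj u v ↔ (u, v) ∈ E ∨ (v, u) ∈ E) ∧
      φ.qr ≤ q ∧ C G φ ∧
      x = encodeInstance E a σ φ ∧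
      IsConsistent G φ a σ}
  param x := x.left.spine

/-! ### Basic facts on trees and runs -/

/-! Neither edges nor quantifiers are needed for hardness: the graph is edgeless, hence a forest of
clique-width at most 2, and the formula is the quantifier-free `MSO.pairOrCollision l`, so `q = 0`.
It holds at `(x₁, x₂)` if both are parameters or if two parameters coincide. When all examples are
negative and there is at least one, consistency asks for `l` distinct vertices such that no example
has both its entries among them. With an example for every conflicting pair, this is the clique
problem for the relation of not being in conflict, where a pair may repeat a vertex.

It remains to reduce every weighted definability problem to such a clique problem. Grounding `∀ x₀ …
x_{d-1}, ψ` over the structure turns it into the search for exactly `k` true variables among `1, …,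
N` that satisfy clauses of a constant length (`QFFormula.wsat_clauses_iff`). Write the true
variables as `0 = t₀ < t₁ < … < t_k < t_{k+1} = N + 1`. A negative literal is violated if its
variable is some `t_j`, a positive one if its variable lies strictly between some `t_j` and
`t_{j+1}`; so two indices per literal suffice to expose a violated clause. The vertices are the
lists of `D` guesses `t_j = u`, where `D` is at least twice the clause length. They conflict if a
boundary value is wrong, a violated clause is visible, or the guesses are not monotone.

The parameter is `l = (k + 2) ^ D`, the number of index sequences of length `D`. A solution provides
one description for each sequence (`WSat.exists_conflictFree`). Conversely, descriptions without
conflict that have the same indices are equal, so `l` distinct ones exhaust all index sequences;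
they determine a single sequence `t`, and any violated clause would be visible in one of them
(`WSat.of_conflictFree`).

As `D` depends only on `ψ`, the construction runs in polynomial time. This is verified by closure
properties of `PolyTime`, whose core is iteration along a list (`PolyTime.foldl_of_bound`). The one
reduction serves both claims: it produces instances under the strongest restriction, and its
soundness needs no restriction (`w1Hard_consistencyProblem`). -/

theorem Polynomial.eval_nat_mono (P : Polynomial ℕ) {a b : ℕ} (h : a ≤ b) :
    P.eval a ≤ P.eval b := by
  rw [Polynomial.eval_eq_sum_range, Polynomial.eval_eq_sum_range]
  gcongr

/-- A coefficient `c ≥ 1` satisfies `c * (a * b) ^ i ≤ (c * a ^ i) * (c * b ^ i)`. This separates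
the parameter from the input size when a polynomial is applied to an fpt running time. -/
theorem Polynomial.eval_nat_mul_le (P : Polynomial ℕ) (a b : ℕ) :
    P.eval (a * b) ≤ P.eval a * P.eval b := by
  simp only [Polynomial.eval_eq_sum_range]
  rw [Finset.sum_mul]
  refine Finset.sum_le_sum fun i hi => ?_
  rcases Nat.eq_zero_or_pos (P.coeff i) with h | h
  · simp [h]
  rw [mul_pow, ← mul_assoc]
  exact Nat.mul_le_mul_left _ ((Nat.le_mul_of_pos_left _ h).trans
    (Finset.single_le_sum (f := fun i => P.coeff i * b ^ i) (fun _ _ => Nat.zero_le _) hi))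

namespace BTree

theorem size_pos (x : BTree) : 0 < x.size := by cases x <;> simp [size]

theorem size_left_le (x : BTree) : x.left.size ≤ x.size := by
  cases x <;> simp [size, left]; omega

theorem size_right_le (x : BTree) : x.right.size ≤ x.size := by
  cases x <;> simp [size, right]; omega

/-- The list that a tree encodes. -/
def toList : BTree → List BTree
  | leaf => []
  | node l r => l :: r.toList

@[simp] theorem ofList_toList (x : BTree) : ofList x.toList = x := by
  induction x with
  | leaf => rfl
  | node l r _ ih => simp [toList, ofList, ih]

@[simp] theorem toList_ofList (l : List BTree) : (ofList l).toList = l := by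
  induction l with
  | nil => rfl
  | cons a l ih => simp [toList, ofList, ih]

theorem ofList_injective : Function.Injective ofList :=
  Function.LeftInverse.injective toList_ofList

@[simp] theorem spine_ofNat (n : ℕ) : (ofNat n).spine = n := by
  induction n with
  | zero => rfl
  | succ n ih => simp [ofNat, spine, ih]

theorem ofNat_injective : Function.Injective ofNat :=
  Function.LeftInverse.injective spine_ofNat

theorem size_ofNat (n : ℕ) : (ofNat n).size = 2 * n + 1 := by
  induction n with
  | zero => rfl
  | succ n ih => simp [ofNat, size, ih]; omega

theorem ofNat_eq_ofList (n : ℕ) : ofNat n = ofList (List.replicate n leaf) := by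
  induction n with
  | zero => rfl
  | succ n ih => simp [ofNat, ofList, ih, List.replicate_succ]

theorem length_toList (x : BTree) : x.toList.length = x.spine := by
  induction x with
  | leaf => rfl
  | node l r _ ih => simp [toList, spine, ih]

theorem size_ofList_append (l l' : List BTree) :
    (ofList (l ++ l')).size + 1 = (ofList l).size + (ofList l').size := by
  induction l with
  | nil => simp [ofList, size]; omega
  | cons a l ih => simp [ofList, size]; omega

theorem ofBool_injective : Function.Injective ofBool := by
  intro a b h
  cases a <;> cases b <;> simp_all [ofBool]

end BTree

/-- Every construct is charged the size of its argument. Hence a time bound also bounds the input of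
the next program in a composition. -/
theorem Runs.size_le {p : Prog} {x y : BTree} {t : ℕ} (h : Runs p x y t) : y.size ≤ t := by
  induction h with
  | skip x => exact le_rfl
  | nil x => exact x.size_pos
  | left x => exact x.size_left_le
  | right x => exact x.size_right_le
  | @pair _ _ x _ _ _ _ _ _ ih1 ih2 =>
    have := x.size_pos
    simp only [BTree.size]; omega
  | _ => omega

/-! ### Functions computable in polynomial time -/

/-- Types whose elements are encoded by trees. -/
class Enc (α : Type) where
  /-- the encoding -/
  enc : α → BTree

open Enc

instance : Enc BTree := ⟨id⟩
instance : Enc ℕ := ⟨BTree.ofNat⟩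
instance : Enc Bool := ⟨BTree.ofBool⟩
instance {α β : Type} [Enc α] [Enc β] : Enc (α × β) := ⟨fun p => .node (enc p.1) (enc p.2)⟩
instance {α : Type} [Enc α] : Enc (List α) := ⟨fun l => .ofList (l.map enc)⟩

theorem enc_tree (x : BTree) : enc x = x := rfl
theorem enc_nat (n : ℕ) : enc n = .ofNat n := rfl
theorem enc_bool (b : Bool) : enc b = .ofBool b := rfl
theorem enc_prod {α β : Type} [Enc α] [Enc β] (p : α × β) :
    enc p = .node (enc p.1) (enc p.2) := rfl
theorem enc_list {α : Type} [Enc α] (l : List α) : enc l = .ofList (l.map enc) := rfl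
theorem enc_cons {α : Type} [Enc α] (a : α) (l : List α) : enc (a :: l) = .node (enc a) (enc l) :=
  rfl

/-- The size of the encoding. -/
def esize {α : Type} [Enc α] (a : α) : ℕ := (enc a).size

theorem esize_pos {α : Type} [Enc α] (a : α) : 0 < esize a := BTree.size_pos _

section
variable {α β γ δ : Type} [Enc α] [Enc β] [Enc γ] [Enc δ]

theorem esize_prod (p : α × β) : esize p = esize p.1 + esize p.2 + 1 := rfl
theorem esize_nil : esize ([] : List α) = 1 := rfl
theorem esize_cons (a : α) (l : List α) : esize (a :: l) = esize a + esize l + 1 := rfl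
theorem esize_append (l l' : List α) : esize (l ++ l') + 1 = esize l + esize l' := by
  simp only [esize, enc_list, List.map_append, BTree.size_ofList_append]
theorem esize_nat (n : ℕ) : esize n = 2 * n + 1 := BTree.size_ofNat n
theorem esize_bool (b : Bool) : esize b ≤ 3 := by cases b <;> decide
theorem length_le_esize (l : List α) : l.length ≤ esize l := by
  induction l with
  | nil => simp
  | cons a l ih => rw [esize_cons, List.length_cons]; omega
theorem esize_le_of_mem {a : α} {l : List α} (h : a ∈ l) : esize a ≤ esize l := by
  induction l with
  | nil => simp at h
  | cons b l ih =>
    rw [esize_cons]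
    rcases List.mem_cons.1 h with rfl | h
    · omega
    · have := ih h; omega

theorem esize_list_le {l : List α} {B : ℕ} (h : ∀ a ∈ l, esize a ≤ B) :
    esize l ≤ l.length * (B + 1) + 1 := by
  induction l with
  | nil => simp [esize_nil]
  | cons a l ih =>
    have h1 := ih fun x hx => h x (List.mem_cons_of_mem _ hx)
    have h2 := h a List.mem_cons_self
    rw [esize_cons, List.length_cons, add_mul, one_mul]
    omega

/-- `f` is computed by a program in polynomial time. -/
@[fun_prop]
def PolyTime (f : α → β) : Prop :=
  ∃ (p : Prog) (P : Polynomial ℕ), ∀ a, ∃ t, Runs p (enc a) (enc (f a)) t ∧ t ≤ P.eval (esize a)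

namespace PolyTime

theorem exists_esize_le {f : α → β} (hf : PolyTime f) :
    ∃ P : Polynomial ℕ, ∀ a, esize (f a) ≤ P.eval (esize a) := by
  obtain ⟨p, P, h⟩ := hf
  refine ⟨P, fun a => ?_⟩
  obtain ⟨t, ht, htP⟩ := h a
  exact ht.size_le.trans htP

/-- The identity program computes every function that does not change the encoding. -/
theorem of_enc_eq {f : α → β} (h : ∀ a, enc (f a) = enc a) : PolyTime f :=
  ⟨.skip, .X, fun a => ⟨_, by rw [h]; exact .skip _, by simp [esize]⟩⟩

@[fun_prop]
theorem id : PolyTime (fun a : α => a) := of_enc_eq fun _ => rfl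

@[fun_prop]
theorem comp {f : β → γ} {g : α → β} (hf : PolyTime f) (hg : PolyTime g) :
    PolyTime (fun a => f (g a)) := by
  obtain ⟨p, P, hp⟩ := hf
  obtain ⟨q, Q, hq⟩ := hg
  refine ⟨.seq q p, Q + P.comp Q + .X, fun a => ?_⟩
  obtain ⟨t, ht, htQ⟩ := hq a
  obtain ⟨u, hu, huP⟩ := hp (g a)
  refine ⟨_, .seq ht hu, ?_⟩
  have := P.eval_nat_mono (ht.size_le.trans htQ)
  simp only [Polynomial.eval_add, Polynomial.eval_comp, Polynomial.eval_X]
  unfold esize at *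
  omega

@[fun_prop]
theorem const (b : β) : PolyTime (fun _ : α => b) := by
  suffices h : ∀ y : BTree, ∃ (p : Prog) (P : Polynomial ℕ), ∀ x : BTree, ∃ t, Runs p x y t ∧
      t ≤ P.eval x.size by
    obtain ⟨p, P, h⟩ := h (enc b)
    exact ⟨p, P, fun a => h (enc a)⟩
  intro y
  induction y with
  | leaf => exact ⟨.nil, .X, fun x => ⟨_, .nil x, by simp⟩⟩
  | node y z ihy ihz =>
    obtain ⟨p, P, hp⟩ := ihy
    obtain ⟨q, Q, hq⟩ := ihz
    refine ⟨.pair p q, P + Q + .X, fun x => ?_⟩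
    obtain ⟨t, ht, htP⟩ := hp x
    obtain ⟨u, hu, huQ⟩ := hq x
    refine ⟨_, .pair ht hu, ?_⟩
    simp only [Polynomial.eval_add, Polynomial.eval_X]
    omega

@[fun_prop]
theorem prodMk {f : α → β} {g : α → γ} (hf : PolyTime f) (hg : PolyTime g) :
    PolyTime (fun a => (f a, g a)) := by
  obtain ⟨p, P, hp⟩ := hf
  obtain ⟨q, Q, hq⟩ := hg
  refine ⟨.pair p q, P + Q + .X, fun x => ?_⟩
  obtain ⟨t, ht, htP⟩ := hp x
  obtain ⟨u, hu, huQ⟩ := hq x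
  refine ⟨_, .pair ht hu, ?_⟩
  simp only [Polynomial.eval_add, Polynomial.eval_X]
  unfold esize at *
  omega

theorem treeLeft : PolyTime BTree.left := ⟨.left, .X, fun a => ⟨_, .left _, by simp [esize]⟩⟩
theorem treeRight : PolyTime BTree.right := ⟨.right, .X, fun a => ⟨_, .right _, by simp [esize]⟩⟩

@[fun_prop]
theorem left {f : α → BTree} (hf : PolyTime f) : PolyTime (fun a => (f a).left) :=
  treeLeft.comp hf

@[fun_prop]
theorem right {f : α → BTree} (hf : PolyTime f) : PolyTime (fun a => (f a).right) :=
  treeRight.comp hf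

@[fun_prop]
theorem encode {f : α → β} (hf : PolyTime f) : PolyTime (fun a => enc (f a)) :=
  comp (f := fun b : β => enc b) (of_enc_eq fun _ => rfl) hf

/-- A function is computable in polynomial time if its composition with the encoding is. -/
theorem of_encode {f : α → β} (hf : PolyTime (fun a => enc (f a))) : PolyTime f := hf

@[fun_prop]
theorem fst {f : α → β × γ} (hf : PolyTime f) : PolyTime (fun a => (f a).1) :=
  of_encode (left (encode hf))

@[fun_prop]
theorem snd {f : α → β × γ} (hf : PolyTime f) : PolyTime (fun a => (f a).2) :=
  of_encode (right (encode hf))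

@[fun_prop]
theorem toList {f : α → BTree} (hf : PolyTime f) : PolyTime (fun a => (f a).toList) :=
  comp (f := BTree.toList) (of_enc_eq fun x => by
    rw [enc_list, show (enc : BTree → BTree) = _root_.id from rfl, List.map_id]; simp) hf

@[fun_prop]
theorem cons {f : α → β} {g : α → List β} (hf : PolyTime f) (hg : PolyTime g) :
    PolyTime (fun a => f a :: g a) :=
  of_encode (encode (prodMk hf hg))

@[fun_prop]
theorem tail {f : α → List β} (hf : PolyTime f) : PolyTime (fun a => (f a).tail) := by
  refine of_encode ?_
  have : (fun a => enc (f a).tail) = fun a => (enc (f a)).right := by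
    ext a
    cases f a <;> rfl
  rw [this]
  fun_prop

@[fun_prop]
theorem cond {b : α → Bool} {f g : α → β} (hb : PolyTime b) (hf : PolyTime f) (hg : PolyTime g) :
    PolyTime (fun a => bif b a then f a else g a) := by
  obtain ⟨c, R, hc⟩ := hb
  obtain ⟨p, P, hp⟩ := hf
  obtain ⟨q, Q, hq⟩ := hg
  refine ⟨.cond c p q, P + Q + R + .X, fun x => ?_⟩
  obtain ⟨r, hr, hrR⟩ := hc x
  obtain ⟨t, ht, htP⟩ := hp x
  obtain ⟨u, hu, huQ⟩ := hq x
  simp only [Polynomial.eval_add, Polynomial.eval_X]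
  unfold esize at *
  cases h : b x
  · rw [h] at hr
    exact ⟨_, .cond_false hr hu, by omega⟩
  · rw [h] at hr
    exact ⟨_, .cond_true hr (by simp [enc, BTree.ofBool]) ht, by omega⟩

-- Normalizes an arbitrary tree to the encoding of a truth value, so that it can serve as the test
-- in `cond`. Comparisons of numbers are reduced to it.
@[fun_prop]
theorem isNode {f : α → BTree} (hf : PolyTime f) :
    PolyTime (fun a => !(f a).toList.isEmpty) := by
  refine comp (f := fun x : BTree => !x.toList.isEmpty)
    ⟨.cond .skip (.pair .nil .nil) .nil, 10 * .X, fun x => ?_⟩ hf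
  cases x with
  | leaf => exact ⟨_, .cond_false (.skip _) (.nil _), by
      simp [esize]; omega⟩
  | node l r =>
    exact ⟨_, .cond_true (.skip _) (by simp [enc]) (.pair (.nil _) (.nil _)), by
      simp [esize, enc]; omega⟩

end PolyTime
end

/-! ### Iteration along lists and the list and Boolean operations derived from it -/

section
variable {α β γ δ : Type} [Enc α] [Enc β] [Enc γ] [Enc δ]
namespace PolyTime

@[fun_prop]
theorem node {f g : α → BTree} (hf : PolyTime f) (hg : PolyTime g) :
    PolyTime (fun a => BTree.node (f a) (g a)) :=
  of_encode (encode (prodMk hf hg))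

@[fun_prop]
theorem ofList {f : α → List BTree} (hf : PolyTime f) : PolyTime (fun a => BTree.ofList (f a)) :=
  comp (f := BTree.ofList) (of_enc_eq fun l => by
    rw [enc_list, show (enc : BTree → BTree) = _root_.id from rfl, List.map_id]; rfl) hf

/-- The loop runs on the state (remaining list, accumulator, context) and stops when the first
component is `leaf`, the empty list. Steps computable in polynomial time could still blow up the
accumulator when iterated, hence the bound `Q` on all intermediate values. -/
theorem foldl_of_bound {l : γ → List α} {i : γ → β} {s : γ → β → α → β} (hl : PolyTime l)
    (hi : PolyTime i) (hs : PolyTime (fun p : γ × β × α => s p.1 p.2.1 p.2.2)) (Q : Polynomial ℕ)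
    (hQ : ∀ c l₁ l₂, l c = l₁ ++ l₂ → esize (l₁.foldl (s c) (i c)) ≤ Q.eval (esize c)) :
    PolyTime (fun c => (l c).foldl (s c) (i c)) := by
  -- Rearranges a state `(a :: l, b, c)` into the argument `(c, b, a)` of the step function.
  have hproj : PolyTime (fun x : BTree => BTree.node x.right.right (.node x.right.left x.left.left)) :=
    by fun_prop
  obtain ⟨p₁, P₁, h₁⟩ := hproj
  obtain ⟨p₂, P₂, h₂⟩ := hs
  -- one step
  have hstep : ∃ (p : Prog) (R : Polynomial ℕ), ∀ (c : γ) (b : β) (a : α) (l : List α),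
      ∃ t, Runs p (enc (a :: l, b, c)) (enc (l, s c b a, c)) t ∧ t ≤ R.eval (esize (a :: l, b, c)) := by
    refine ⟨.pair (.seq .left .right) (.pair (.seq p₁ p₂) (.seq .right .right)),
      P₁ + P₂ + 20 * .X, fun c b a l => ?_⟩
    obtain ⟨t, ht, htP⟩ := h₁ (enc (a :: l, b, c))
    obtain ⟨u, hu, huP⟩ := h₂ (c, b, a)
    refine ⟨_, .pair (.seq (.left _) (.right _)) (.pair (.seq ht hu) (.seq (.right _) (.right _))), ?_⟩
    have e1 := (enc (a :: l, b, c)).size_left_le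
    have e2 := (enc (a :: l, b, c)).size_right_le
    have e3 := P₂.eval_nat_mono (show esize (c, b, a) ≤ esize (a :: l, b, c) by
      simp only [esize_prod, esize_cons]; omega)
    simp only [Polynomial.eval_add, Polynomial.eval_mul, Polynomial.eval_X,
      Polynomial.eval_ofNat]
    change t ≤ P₁.eval (esize (a :: l, b, c)) at htP
    unfold esize at *
    omega
  obtain ⟨p, R, hp⟩ := hstep
  -- the loop
  have hloop : ∀ (c : γ) (B : ℕ) (l : List α) (b : β),
      (∀ l₁ l₂, l = l₁ ++ l₂ → esize (l₂, l₁.foldl (s c) b, c) ≤ B) →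
      ∃ t, Runs (.loop .left p) (enc (l, b, c)) (enc (([] : List α), l.foldl (s c) b, c)) t ∧
        t ≤ (l.length + 1) * (R.eval B + 2 * B) := by
    intro c B l
    induction l with
    | nil =>
      intro b hB
      refine ⟨_, Runs.loop_stop (.left _), ?_⟩
      have := hB [] [] rfl
      simp only [List.foldl_nil, esize] at this
      simp only [List.length_nil]
      omega
    | cons a l ih =>
      intro b hB
      obtain ⟨t, ht, htR⟩ := hp c b a l
      obtain ⟨u, hu, huB⟩ := ih (s c b a) fun l₁ l₂ h => hB (a :: l₁) l₂ (by rw [h]; rfl)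
      refine ⟨_, .loop_step (.left _) (by simp [enc_prod, BTree.left, enc_cons]) ht hu, ?_⟩
      have h0 := hB [] (a :: l) rfl
      rw [List.foldl_nil] at h0
      have h1 := R.eval_nat_mono h0
      rw [List.length_cons, add_mul (l.length + 1), one_mul]
      unfold esize at *
      omega
  -- the result
  obtain ⟨q, U, hq⟩ := (hl.prodMk (hi.prodMk id))
  obtain ⟨Pl, hPl⟩ := hl.exists_esize_le
  obtain ⟨B, hB⟩ : ∃ B : Polynomial ℕ, ∀ c l₁ l₂, l c = l₁ ++ l₂ →
      esize (l₂, l₁.foldl (s c) (i c), c) ≤ B.eval (esize c) := by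
    refine ⟨Pl + Q + .X + 2, fun c l₁ l₂ h => ?_⟩
    have h1 := hQ c l₁ l₂ h
    have h2 := hPl c
    rw [h] at h2
    have := esize_append l₁ l₂
    have := esize_pos l₁
    simp only [esize_prod, Polynomial.eval_add, Polynomial.eval_X, Polynomial.eval_ofNat]
    omega
  refine ⟨.seq q (.seq (.loop .left p) (.seq .right .left)),
    U + (Pl + 1) * (R.comp B + 2 * B) + 20 * B, fun c => ?_⟩
  obtain ⟨t, ht, htU⟩ := hq c
  obtain ⟨u, hu, huB⟩ := hloop c _ (l c) (i c) (hB c)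
  refine ⟨_, .seq ht (.seq hu (.seq (.right _) (.left _))), ?_⟩
  have h1 := hB c [] (l c) rfl
  have h2 := hB c (l c) [] (by simp)
  rw [List.foldl_nil] at h1
  have h3 := (length_le_esize (l c)).trans (hPl c)
  have h4 := (enc (([] : List α), (l c).foldl (s c) (i c), c)).size_right_le
  have h5 := huB.trans (Nat.mul_le_mul_right _ (Nat.succ_le_succ h3))
  have h6 : esize c ≤ B.eval (esize c) := by
    simp only [esize_prod] at h1
    omega
  simp only [Polynomial.eval_add, Polynomial.eval_mul, Polynomial.eval_comp, Polynomial.eval_one,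
    Polynomial.eval_ofNat]
  rw [Nat.succ_eq_add_one] at h5
  unfold esize at *
  generalize (Polynomial.eval (enc c).size Pl + 1) * _ = M at *
  omega

/-- Iteration along a list, where each step adds at most a polynomial amount. -/
theorem foldl {l : γ → List α} {i : γ → β} {s : γ → β → α → β} (hl : PolyTime l)
    (hi : PolyTime i) (hs : PolyTime (fun p : γ × β × α => s p.1 p.2.1 p.2.2))
    (hQ : ∃ Q : Polynomial ℕ, ∀ c b a, esize (s c b a) ≤ esize b + Q.eval (esize (c, a))) :
    PolyTime (fun c => (l c).foldl (s c) (i c)) := by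
  obtain ⟨Q, hQ⟩ := hQ
  obtain ⟨Pl, hPl⟩ := hl.exists_esize_le
  obtain ⟨Pi, hPi⟩ := hi.exists_esize_le
  refine foldl_of_bound hl hi hs (Pi + Pl * Q.comp (.X + Pl + 1)) fun c l₁ l₂ h => ?_
  have hmem : ∀ a ∈ l₁, esize a ≤ Pl.eval (esize c) := fun a ha =>
    (esize_le_of_mem (by rw [h]; exact List.mem_append_left _ ha)).trans (hPl c)
  have hlen : l₁.length ≤ Pl.eval (esize c) := by
    have := (length_le_esize (l c)).trans (hPl c)
    rw [h, List.length_append] at this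
    omega
  have key : ∀ b, esize (l₁.foldl (s c) b) ≤
      esize b + l₁.length * Q.eval (esize c + Pl.eval (esize c) + 1) := by
    clear h hlen
    induction l₁ with
    | nil => simp
    | cons a l ih =>
      intro b
      have h1 := ih (fun x hx => hmem x (List.mem_cons_of_mem _ hx)) (s c b a)
      have h2 := hQ c b a
      have h3 := Q.eval_nat_mono (show esize (c, a) ≤ esize c + Pl.eval (esize c) + 1 by
        have := hmem a List.mem_cons_self
        simp only [esize_prod]; omega)
      rw [List.foldl_cons, List.length_cons, add_mul, one_mul]
      omega
  refine (key _).trans ?_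
  simp only [Polynomial.eval_add, Polynomial.eval_mul, Polynomial.eval_comp, Polynomial.eval_X,
    Polynomial.eval_one]
  exact add_le_add (hPi c) (Nat.mul_le_mul_right _ hlen)

@[fun_prop]
theorem reverse {l : γ → List α} (hl : PolyTime l) : PolyTime (fun c => (l c).reverse) := by
  have : (fun c => (l c).reverse) = fun c => (l c).foldl (fun b a => a :: b) [] := by
    ext1 c; simp
  rw [this]
  refine foldl (s := fun _ b a => a :: b) hl (by fun_prop) (by fun_prop) ⟨.X + 1, fun c b a => ?_⟩
  simp only [esize_cons, esize_prod, Polynomial.eval_add, Polynomial.eval_X, Polynomial.eval_one]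
  omega

@[fun_prop]
theorem append {l l' : γ → List α} (hl : PolyTime l) (hl' : PolyTime l') :
    PolyTime (fun c => l c ++ l' c) := by
  have : (fun c => l c ++ l' c) = fun c => (l c).reverse.foldl (fun b a => a :: b) (l' c) := by
    ext1 c; simp
  rw [this]
  refine foldl (s := fun _ b a => a :: b) (by fun_prop) hl' (by fun_prop)
    ⟨.X + 1, fun c b a => ?_⟩
  simp only [esize_cons, esize_prod, Polynomial.eval_add, Polynomial.eval_X, Polynomial.eval_one]
  omega

@[fun_prop]
theorem flatMap {l : γ → List α} {f : γ → α → List β} (hl : PolyTime l)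
    (hf : PolyTime (fun p : γ × α => f p.1 p.2)) : PolyTime (fun c => (l c).flatMap (f c)) := by
  have : (fun c => (l c).flatMap (f c)) = fun c => (l c).foldl (fun b a => b ++ f c a) [] := by
    ext1 c
    have h : ∀ (l : List α) (b : List β), l.foldl (fun b a => b ++ f c a) b = b ++ l.flatMap (f c) := by
      intro l
      induction l with
      | nil => simp
      | cons a l ih => intro b; simp [ih]
    rw [h, List.nil_append]
  rw [this]
  obtain ⟨P, hP⟩ := hf.exists_esize_le
  refine foldl (s := fun c b a => b ++ f c a) hl (by fun_prop) ?_ ⟨P, fun c b a => ?_⟩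
  · exact append (by fun_prop) (comp (g := fun p : γ × List β × α => (p.1, p.2.2)) hf (by fun_prop))
  · have := esize_append b (f c a)
    have : esize (f c a) ≤ _ := hP (c, a)
    omega

@[fun_prop]
theorem map {l : γ → List α} {f : γ → α → β} (hl : PolyTime l)
    (hf : PolyTime (fun p : γ × α => f p.1 p.2)) : PolyTime (fun c => (l c).map (f c)) := by
  have : (fun c => (l c).map (f c)) = fun c => (l c).flatMap (fun a => [f c a]) := by
    ext1 c; induction l c <;> simp_all
  rw [this]
  exact flatMap (f := fun c a => [f c a]) hl (cons hf (by fun_prop))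

@[fun_prop]
theorem and {f g : α → Bool} (hf : PolyTime f) (hg : PolyTime g) :
    PolyTime (fun a => f a && g a) := by
  have : (fun a => f a && g a) = fun a => bif f a then g a else false := by
    ext1 a; cases f a <;> rfl
  rw [this]; fun_prop

@[fun_prop]
theorem or {f g : α → Bool} (hf : PolyTime f) (hg : PolyTime g) :
    PolyTime (fun a => f a || g a) := by
  have : (fun a => f a || g a) = fun a => bif f a then true else g a := by
    ext1 a; cases f a <;> rfl
  rw [this]; fun_prop

@[fun_prop]
theorem not {f : α → Bool} (hf : PolyTime f) : PolyTime (fun a => !f a) := by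
  have : (fun a => !f a) = fun a => bif f a then false else true := by
    ext1 a; cases f a <;> rfl
  rw [this]; fun_prop

@[fun_prop]
theorem all {l : γ → List α} {f : γ → α → Bool} (hl : PolyTime l)
    (hf : PolyTime (fun p : γ × α => f p.1 p.2)) : PolyTime (fun c => (l c).all (f c)) := by
  have : (fun c => (l c).all (f c)) = fun c => (l c).foldl (fun b a => b && f c a) true := by
    ext1 c
    have h : ∀ (l : List α) (b : Bool), l.foldl (fun b a => b && f c a) b = (b && l.all (f c)) := by
      intro l
      induction l with
      | nil => simp
      | cons a l ih => intro b; simp [ih, Bool.and_assoc]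
    rw [h, Bool.true_and]
  rw [this]
  refine foldl (s := fun c b a => b && f c a) hl (by fun_prop) ?_ ⟨3, fun c b a => ?_⟩
  · exact and (by fun_prop) (comp (g := fun p : γ × Bool × α => (p.1, p.2.2)) hf (by fun_prop))
  · have := esize_bool (b && f c a)
    simp; omega

@[fun_prop]
theorem any {l : γ → List α} {f : γ → α → Bool} (hl : PolyTime l)
    (hf : PolyTime (fun p : γ × α => f p.1 p.2)) : PolyTime (fun c => (l c).any (f c)) := by
  have : (fun c => (l c).any (f c)) = fun c => !(l c).all (fun a => !f c a) := by
    ext1 c; rw [List.any_eq_not_all_not]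
  rw [this]
  exact not (all (f := fun c a => !f c a) hl (not hf))

/-! ### Numbers -/

@[fun_prop]
theorem length {l : γ → List α} (hl : PolyTime l) : PolyTime (fun c => (l c).length) := by
  have : PolyTime (fun c => (l c).map fun _ => BTree.leaf) := by fun_prop
  refine of_encode ?_
  convert this.encode using 2 with c
  rw [enc_nat, enc_list, BTree.ofNat_eq_ofList]
  congr 1
  induction l c <;> simp_all [List.replicate_succ, enc_tree]

@[fun_prop]
theorem spine {f : γ → BTree} (hf : PolyTime f) : PolyTime (fun c => (f c).spine) := by
  simp only [← BTree.length_toList]; fun_prop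

/-- A number, as a list. -/
theorem replicate_leaf {f : γ → ℕ} (hf : PolyTime f) :
    PolyTime (fun c => List.replicate (f c) BTree.leaf) := by
  have := hf.encode.toList
  simpa only [enc_nat, BTree.ofNat_eq_ofList, BTree.toList_ofList] using this

-- The list is built in reverse by pushing its current length. The growth of a step depends on the
-- accumulator, so `foldl` does not apply, and the sizes are bounded through `foldl_of_bound`: all
-- entries are smaller than the number of steps.
@[fun_prop]
theorem range {f : γ → ℕ} (hf : PolyTime f) : PolyTime (fun c => List.range (f c)) := by
  have : (fun c => List.range (f c)) = fun c => (((List.replicate (f c) BTree.leaf).foldl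
      (fun b _ => b.length :: b) ([] : List ℕ))).reverse := by
    ext1 c
    induction f c with
    | zero => rfl
    | succ n ih =>
      rw [List.replicate_succ', List.foldl_append, List.range_succ, ih]
      have : ((List.replicate n BTree.leaf).foldl (fun b _ => b.length :: b) ([] : List ℕ)).length
          = n := by
        rw [← List.length_reverse, ← ih, List.length_range]
      simp [this]
  rw [this]
  obtain ⟨P, hP⟩ := hf.exists_esize_le
  refine reverse (foldl_of_bound (s := fun _ b _ => b.length :: b) (replicate_leaf hf) (const _)
    (by fun_prop) (P * (2 * P + 2) + 1) fun c l₁ l₂ h => ?_)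
  have key : ∀ l : List BTree, (l.foldl (fun b _ => b.length :: b) ([] : List ℕ)).length = l.length ∧
      ∀ a ∈ l.foldl (fun b _ => b.length :: b) ([] : List ℕ), a < l.length := by
    intro l
    induction l using List.reverseRecOn with
    | nil => simp
    | append_singleton l x ih =>
      rw [List.foldl_append, List.foldl_cons, List.foldl_nil, List.length_append]
      refine ⟨by simp [ih.1], fun a ha => ?_⟩
      rcases List.mem_cons.1 ha with h | h
      · rw [h, ih.1]; simp
      · have := ih.2 a h; omega
  have hlen : l₁.length ≤ P.eval (esize c) := by
    have h1 := congrArg List.length h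
    have h2 := hP c
    rw [List.length_replicate, List.length_append] at h1
    rw [esize_nat] at h2
    omega
  have := esize_list_le (B := 2 * l₁.length + 1) fun a ha => by
    have := (key l₁).2 a ha
    rw [esize_nat]; omega
  rw [(key l₁).1] at this
  simp only [Polynomial.eval_add, Polynomial.eval_mul, Polynomial.eval_one, Polynomial.eval_ofNat]
  refine this.trans (Nat.succ_le_succ (Nat.mul_le_mul hlen ?_))
  omega

@[fun_prop]
theorem sub {f g : γ → ℕ} (hf : PolyTime f) (hg : PolyTime g) :
    PolyTime (fun c => f c - g c) := by
  have : (fun c => f c - g c) = fun c => ((List.replicate (g c) BTree.leaf).foldl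
      (fun b _ => b.tail) (List.replicate (f c) BTree.leaf)).length := by
    ext1 c
    induction g c with
    | zero => simp
    | succ n ih => rw [List.replicate_succ', List.foldl_append]; simp [← ih]; omega
  rw [this]
  refine length (foldl (s := fun _ b _ => b.tail) (replicate_leaf hg) (replicate_leaf hf)
    (by fun_prop) ⟨0, fun c b a => ?_⟩)
  cases b with
  | nil => simp
  | cons a b => rw [List.tail_cons, esize_cons]; omega

@[fun_prop]
theorem add {f g : γ → ℕ} (hf : PolyTime f) (hg : PolyTime g) :
    PolyTime (fun c => f c + g c) := by
  have := length (append (replicate_leaf hf) (replicate_leaf hg))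
  simpa using this

@[fun_prop]
theorem mul {f g : γ → ℕ} (hf : PolyTime f) (hg : PolyTime g) :
    PolyTime (fun c => f c * g c) := by
  have : PolyTime fun c => ((List.range (f c)).flatMap (fun _ => List.range (g c))).length := by
    fun_prop
  simpa using this

@[fun_prop]
theorem pow {f : γ → ℕ} (hf : PolyTime f) (n : ℕ) : PolyTime (fun c => f c ^ n) := by
  induction n with
  | zero => simp only [pow_zero]; fun_prop
  | succ n ih => simp only [pow_succ]; fun_prop

@[fun_prop]
theorem decide_lt {f g : γ → ℕ} (hf : PolyTime f) (hg : PolyTime g) :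
    PolyTime (fun c => decide (f c < g c)) := by
  have : PolyTime fun c => !(enc (g c - f c)).toList.isEmpty := by fun_prop
  convert this using 2 with c
  rw [enc_nat, BTree.ofNat_eq_ofList, BTree.toList_ofList]
  rw [List.isEmpty_replicate]
  by_cases h : f c < g c
  · simp [h]; omega
  · simp [h]; omega

@[fun_prop]
theorem decide_eq {f g : γ → ℕ} (hf : PolyTime f) (hg : PolyTime g) :
    PolyTime (fun c => decide (f c = g c)) := by
  have : PolyTime fun c => !decide (f c < g c) && !decide (g c < f c) := by fun_prop
  convert this using 2 with c
  grind

@[fun_prop]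
theorem finset_sum {ι : Type*} (s : Finset ι) {f : γ → ι → ℕ} (hf : ∀ i, PolyTime fun c => f c i) :
    PolyTime (fun c => ∑ i ∈ s, f c i) := by
  classical
  induction s using Finset.induction_on with
  | empty => simp only [Finset.sum_empty]; fun_prop
  | insert a s ha ih => simp only [Finset.sum_insert ha]; fun_prop

end PolyTime
end

/-! ### Reductions -/

theorem Polynomial.computable_eval (P : Polynomial ℕ) : Computable fun n => P.eval n := by
  suffices h : Primrec fun n => P.eval n from h.to_comp
  induction P using Polynomial.induction_on' with
  | add p q hp hq => simpa only [Polynomial.eval_add] using Primrec.nat_add.comp hp hq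
  | monomial n a =>
    simp only [Polynomial.eval_monomial]
    refine Primrec.nat_mul.comp (Primrec.const a) ?_
    induction n with
    | zero => simpa using Primrec.const 1
    | succ n ih =>
      simp only [pow_succ]
      exact Primrec.nat_mul.comp ih Primrec.id

/-- Composition of an fpt reduction with a polynomial time reduction. -/
theorem FptReducible.trans_polyTime {A B C : ParamProblem} (h : FptReducible A B)
    {r : BTree → BTree} (hr : PolyTime r) (hyes : ∀ y, y ∈ B.yes ↔ r y ∈ C.yes)
    (Q : Polynomial ℕ) (hparam : ∀ y, C.param (r y) ≤ Q.eval (B.param y)) : FptReducible A C := by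
  obtain ⟨p, f, g, P, hf, hg, h⟩ := h
  obtain ⟨q, R, hq⟩ := hr
  refine ⟨.seq p q, fun n => f n + R.eval (f n) + 1, fun n => Q.eval (g n), P + R.comp P + .X,
    ?_, Q.computable_eval.comp hg, fun x => ?_⟩
  · exact ((Primrec.nat_add.to_comp.comp (Primrec.nat_add.to_comp.comp hf
      (R.computable_eval.comp hf)) (Computable.const 1)))
  · obtain ⟨y, t, ht, htP, hxy, hyx⟩ := h x
    obtain ⟨u, hu, huR⟩ := hq y
    refine ⟨r y, _, .seq ht hu, ?_, hxy.trans (hyes y), (hparam y).trans (Q.eval_nat_mono hyx)⟩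
    have h1 := huR.trans (R.eval_nat_mono (ht.size_le.trans htP))
    -- The bound `R (f * P)` is split into `R f * R P`: a factor depending on the parameter and a
    -- polynomial in the input size.
    have h2 := h1.trans (R.eval_nat_mul_le _ _)
    simp only [Polynomial.eval_add, Polynomial.eval_comp, Polynomial.eval_X]
    generalize f (A.param x) = a at *
    generalize Polynomial.eval x.size P = b at *
    generalize Polynomial.eval b R = b' at *
    generalize Polynomial.eval a R = a' at *
    nlinarith [Nat.zero_le (a * b'), Nat.zero_le (a' * b), Nat.zero_le (a * x.size),
      Nat.zero_le (a' * x.size)]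

/-! ### Clique-width of edgeless graphs -/

/-- Isolated vertices are added one at a time by disjoint union, without labels. The graph has `n +
1` vertices because no expression describes the empty graph. -/
theorem described_bot (n : ℕ) : ∃ (W : Type) (H : SimpleGraph W) (lab : Fin 2 → Set W),
    Described H lab ∧ Nonempty ((⊥ : SimpleGraph (Fin (n + 1))) ≃g H) := by
  induction n with
  | zero =>
    refine ⟨_, _, _, Described.base ∅, ⟨⟨Equiv.ofUnique (Fin 1) Unit, ?_⟩⟩⟩
    simp
  | succ n ih =>
    obtain ⟨W, H, lab, hH, ⟨e⟩⟩ := ih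
    obtain ⟨ε⟩ : Nonempty (Fin (n + 1 + 1) ≃ W ⊕ Unit) :=
      ⟨finSumFinEquiv.symm.trans (Equiv.sumCongr e.toEquiv (Equiv.ofUnique (Fin 1) Unit))⟩
    refine ⟨_, _, _, hH.union (Described.base ∅), ⟨⟨ε, ?_⟩⟩⟩
    intro a b
    simp only [SimpleGraph.bot_adj, iff_false]
    have hbot : ∀ u v, ¬ H.Adj u v := fun u v h => by
      have := e.symm.map_rel_iff.2 h
      simp at this
    generalize ε a = u
    generalize ε b = v
    rcases u with u | u <;> rcases v with v | v <;> simp [hbot]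

theorem cliqueWidth_bot_le (n : ℕ) (hn : 0 < n) : cliqueWidth (⊥ : SimpleGraph (Fin n)) ≤ 2 := by
  obtain ⟨n, rfl⟩ := Nat.exists_eq_succ_of_ne_zero hn.ne'
  exact iInf₂_le_of_le 2 (described_bot n) le_rfl

/-! ### Encodings of formulas -/

namespace MSO

/-- The tree does not record the numbers `a` and `b` of available variables, so a formula is
recovered only once these are fixed. In an instance they are known from the encoded `l`. -/
theorem encode_injective : ∀ {a b : ℕ} (φ ψ : MSO a b), φ.encode = ψ.encode → φ = ψ := by
  intro a b φ
  induction φ with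
  | eq x y | adj x y =>
    intro ψ h
    cases ψ <;> simp only [encode, BTree.node.injEq, BTree.ofNat_injective.eq_iff] at h <;>
      simp_all [Fin.ext_iff]
  | mem x X =>
    intro ψ h
    cases ψ <;> simp only [encode, BTree.node.injEq, BTree.ofNat_injective.eq_iff] at h <;>
      simp_all [Fin.ext_iff]
  | neg φ ih | ex φ ih | all φ ih | exSet φ ih | allSet φ ih =>
    intro ψ h
    cases ψ <;> simp only [encode, BTree.node.injEq, BTree.ofNat_injective.eq_iff] at h <;>
      first
      | (obtain ⟨h, -⟩ := h; omega)
      | rw [ih _ h.2]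
  | conj φ χ ih ih' | disj φ χ ih ih' =>
    intro ψ h
    cases ψ <;> simp only [encode, BTree.node.injEq, BTree.ofNat_injective.eq_iff] at h <;>
      first
      | (obtain ⟨h, -⟩ := h; omega)
      | rw [ih _ h.2.1, ih' _ h.2.2]

/-- The disjunction of a list of equalities of variables. -/
def orEq {a b : ℕ} (z : Fin a) : List (Fin a × Fin a) → MSO a b
  -- There is no atom for falsity; the variable `z` serves only to express it.
  | [] => neg (eq z z)
  | p :: l => disj (eq p.1 p.2) (orEq z l)

/-- The encoding of `orEq`. -/
def orEqCode (z : ℕ) (l : List (ℕ × ℕ)) : BTree :=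
  -- The disjunctions are nested to the right, so the code is itself a list: each disjunct
  -- contributes the symbol 5 and the code of an equality, and the code of the final negation is
  -- appended. This form is covered by the list operations of `PolyTime`.
  .ofList (l.flatMap (fun p => [.ofNat 5, enc ((0 : ℕ), p)]) ++
    (BTree.node (.ofNat 3) (enc ((0 : ℕ), (z, z)))).toList)

theorem encode_orEq {a b : ℕ} (z : Fin a) (l : List (Fin a × Fin a)) :
    (orEq z l : MSO a b).encode = orEqCode z (l.map fun p => ((p.1 : ℕ), (p.2 : ℕ))) := by
  induction l with
  | nil => simp [orEq, orEqCode, encode, enc_prod, enc_nat]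
  | cons p l ih => simp [orEq, orEqCode, encode, enc_prod, enc_nat, ih, BTree.ofList] at ih ⊢

theorem holds_orEq {a b : ℕ} (z : Fin a) (l : List (Fin a × Fin a)) {V : Type}
    (G : SimpleGraph V) (v : Fin a → V) (W : Fin b → Set V) :
    (orEq z l : MSO a b).Holds G v W ↔ ∃ p ∈ l, v p.1 = v p.2 := by
  induction l with
  | nil => simp [orEq, Holds]
  | cons p l ih => simp [orEq, Holds, ih]

theorem qr_orEq {a b : ℕ} (z : Fin a) (l : List (Fin a × Fin a)) :
    (orEq z l : MSO a b).qr = 0 := by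
  induction l with
  | nil => rfl
  | cons p l ih => simp [orEq, qr, ih]

theorem size_encode_orEq {a b : ℕ} (z : Fin a) (l : List (Fin a × Fin a)) :
    (orEq z l : MSO a b).encode.size ≤ (l.length + 1) * (4 * a + 20) := by
  induction l with
  | nil => simp [orEq, encode, BTree.size, BTree.size_ofNat]; omega
  | cons p l ih =>
    have := p.1.2
    have := p.2.2
    simp only [orEq, encode, BTree.size, BTree.size_ofNat, List.length_cons]
    rw [add_mul (l.length + 1), one_mul]
    omega

/-- The formula which says that both instance variables are among the parameters, or that two
parameters coincide. -/
def pairOrCollision (l : ℕ) : MSO (2 + l) 0 :=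
  disj (conj (orEq (Fin.castAdd l 0) ((List.finRange l).map fun i =>
        (Fin.castAdd l 0, Fin.natAdd 2 i)))
      (orEq (Fin.castAdd l 0) ((List.finRange l).map fun i =>
        (Fin.castAdd l 1, Fin.natAdd 2 i))))
    (orEq (Fin.castAdd l 0) ((List.finRange l).flatMap fun i =>
      ((List.finRange l).filter fun j => j < i).map fun j => (Fin.natAdd 2 i, Fin.natAdd 2 j)))

theorem holds_pairOrCollision {l : ℕ} {V : Type} (G : SimpleGraph V) (a : Fin 2 → V)
    (w : Fin l → V) (W : Fin 0 → Set V) :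
    (pairOrCollision l).Holds G (Fin.append a w) W ↔
      (a 0 ∈ Set.range w ∧ a 1 ∈ Set.range w) ∨ ¬ w.Injective := by
  have h : (∃ i j, j < i ∧ w i = w j) ↔ ¬ w.Injective := by
    rw [Function.not_injective_iff]
    constructor
    · rintro ⟨i, j, h, e⟩; exact ⟨i, j, e, h.ne'⟩
    · rintro ⟨i, j, e, h⟩
      rcases lt_or_gt_of_ne h with h | h
      · exact ⟨j, i, h, e.symm⟩
      · exact ⟨i, j, h, e⟩
  rw [← h]
  simp [pairOrCollision, Holds, holds_orEq, eq_comm]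

theorem qr_pairOrCollision (l : ℕ) : (pairOrCollision l).qr = 0 := by
  simp [pairOrCollision, qr, qr_orEq]

/-- The encoding of `pairOrCollision`. -/
def pairOrCollisionCode (l : ℕ) : BTree :=
  enc ((5 : ℕ), (((4 : ℕ), (orEqCode 0 ((List.range l).map fun i => (0, 2 + i)),
      orEqCode 0 ((List.range l).map fun i => (1, 2 + i)))),
    orEqCode 0 ((List.range l).flatMap fun i => (List.range l).flatMap fun j =>
      bif decide (j < i) then [(2 + i, 2 + j)] else [])))

theorem encode_pairOrCollision (l : ℕ) :
    (pairOrCollision l).encode = pairOrCollisionCode l := by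
  have h (f : ℕ → ℕ × ℕ) : (List.range l).map f = (List.finRange l).map fun i : Fin l => f i := by
    rw [← List.map_coe_finRange_eq_range, List.map_map]; rfl
  have h' (f : ℕ → List (ℕ × ℕ)) :
      (List.range l).flatMap f = (List.finRange l).flatMap fun i : Fin l => f i := by
    rw [← List.map_coe_finRange_eq_range, List.flatMap_map]
  simp only [pairOrCollision, pairOrCollisionCode, encode, encode_orEq, enc_prod, enc_nat, enc_tree,
    h, h', List.map_map, List.map_flatMap]
  congr 4
  ext1 i
  induction List.finRange l with
  | nil => rfl
  | cons j L ih =>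
    rw [List.flatMap_cons, ← ih, List.filter_cons]
    by_cases hj : j < i <;> simp [hj]

theorem size_encode_pairOrCollision (l : ℕ) : (pairOrCollision l).encode.size ≤
    ((l + 1) + (l + 1) + (l * l + 1)) * (4 * (2 + l) + 20) + 30 := by
  have h1 : ∀ L : List (Fin l), (L.flatMap fun i => ((List.finRange l).filter fun j => j < i).map
      fun j => ((Fin.natAdd 2 i : Fin (2 + l)), (Fin.natAdd 2 j : Fin (2 + l)))).length
        ≤ L.length * l := by
    intro L
    induction L with
    | nil => simp
    | cons i L ih =>
      have := List.length_filter_le (fun j => decide (j < i)) (List.finRange l)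
      rw [List.length_finRange] at this
      rw [List.flatMap_cons, List.length_append, List.length_map, List.length_cons, add_mul,
        one_mul]
      omega
  have h2 := h1 (List.finRange l)
  rw [List.length_finRange] at h2
  have e1 := size_encode_orEq (b := 0) (Fin.castAdd l 0) ((List.finRange l).map fun i =>
    ((Fin.castAdd l 0 : Fin (2 + l)), (Fin.natAdd 2 i : Fin (2 + l))))
  have e2 := size_encode_orEq (b := 0) (Fin.castAdd l 0) ((List.finRange l).map fun i =>
    ((Fin.castAdd l 1 : Fin (2 + l)), (Fin.natAdd 2 i : Fin (2 + l))))
  have e3 := (size_encode_orEq (b := 0) (Fin.castAdd l 0) ((List.finRange l).flatMap fun i =>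
    ((List.finRange l).filter fun j => j < i).map fun j =>
      ((Fin.natAdd 2 i : Fin (2 + l)), (Fin.natAdd 2 j : Fin (2 + l))))).trans
    (Nat.mul_le_mul_right _ (Nat.succ_le_succ h2))
  rw [List.length_map, List.length_finRange] at e1 e2
  rw [Nat.succ_eq_add_one] at e3
  simp only [pairOrCollision, encode, BTree.size, BTree.size_ofNat]
  rw [add_mul, add_mul (l + 1)]
  omega

theorem polyTime_orEqCode {α : Type} [Enc α] (z : ℕ) {f : α → List (ℕ × ℕ)} (hf : PolyTime f) :
    PolyTime fun a => orEqCode z (f a) := by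
  unfold orEqCode
  fun_prop

theorem polyTime_pairOrCollisionCode {α : Type} [Enc α] {f : α → ℕ} (hf : PolyTime f) :
    PolyTime fun a => pairOrCollisionCode (f a) := by
  unfold pairOrCollisionCode
  refine .encode (.prodMk (.const _) (.prodMk (.prodMk (.const _) (.prodMk
    (polyTime_orEqCode _ ?_) (polyTime_orEqCode _ ?_))) (polyTime_orEqCode _ ?_)))
  · fun_prop
  · fun_prop
  · fun_prop

end MSO

/-! ### Weighted satisfiability as a problem of pairwise compatible partial descriptions -/

/-- All lists of length `d` over a list. -/
def allLists {α : Type} : ℕ → List α → List (List α)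
  | 0, _ => [[]]
  | d + 1, l => l.flatMap fun a => (allLists d l).map fun v => a :: v

theorem mem_allLists {α : Type} {d : ℕ} {l : List α} {v : List α} :
    v ∈ allLists d l ↔ v.length = d ∧ ∀ x ∈ v, x ∈ l := by
  induction d generalizing v with
  | zero => simp +contextual [allLists, List.length_eq_zero_iff]
  | succ d ih =>
    cases v with
    | nil => simp [allLists]
    | cons a v => simp [allLists, ih]; tauto

theorem nodup_allLists {α : Type} (d : ℕ) {l : List α} (hl : l.Nodup) :
    (allLists d l).Nodup := by
  induction d with
  | zero => simp [allLists]
  | succ d ih =>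
    rw [allLists, List.nodup_flatMap]
    refine ⟨fun a _ => ih.map fun x y h => (List.cons.inj h).2, hl.imp fun {a b} hab => ?_⟩
    intro v hv hv'
    simp only [List.mem_map] at hv hv'
    obtain ⟨x, -, rfl⟩ := hv
    obtain ⟨y, -, h⟩ := hv'
    exact hab (List.cons.inj h).1.symm

/-- A clause is a list of signed variables.  `WSat k N cls`: some set of exactly `k` of the variables
`1, …, N` satisfies the clauses. -/
def WSat (k N : ℕ) (cls : List (List (ℕ × Bool))) : Prop :=
  ∃ T : Finset ℕ, T ⊆ Finset.Icc 1 N ∧ T.card = k ∧ ∀ cl ∈ cls, ∃ p ∈ cl, (p.1 ∈ T ↔ p.2 = true)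

namespace WSat

/-- The partial descriptions of a sequence `0 = t_0 < t_1 < … < t_k < t_{k+1} = N + 1`: lists of `D`
pairs `(j, u)`, which stand for `t_j = u`. -/
def descriptions (D k N : ℕ) : List (List (ℕ × ℕ)) :=
  allLists D ((List.range (k + 2)).flatMap fun j => (List.range (N + 2)).map fun u => (j, u))

/-- The description has the right values at the ends. -/
def Bounded (k N : ℕ) (v : List (ℕ × ℕ)) : Bool :=
  v.all fun x => (!decide (x.1 = 0) || decide (x.2 = 0)) &&
    (!decide (x.1 = k + 1) || decide (x.2 = N + 1))

/-- The description shows that some clause is violated by `{t_1, …, t_k}`. -/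
def Violates (cls : List (List (ℕ × Bool))) (v : List (ℕ × ℕ)) : Bool :=
  cls.any fun cl => cl.all fun p =>
    bif p.2 then v.any fun x => v.any fun y =>
      decide (y.1 = x.1 + 1) && (decide (x.2 < p.1) && decide (p.1 < y.2))
    else v.any fun x => decide (x.2 = p.1)

/-- The union of the two descriptions is monotone. -/
def Monotone (v v' : List (ℕ × ℕ)) : Bool :=
  v.all fun x => v'.all fun y => (!decide (x.1 < y.1) || decide (x.2 < y.2)) &&
    (!decide (x.1 = y.1) || decide (x.2 = y.2))

/-- The two descriptions cannot both belong to a solution. -/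
def Conflict (k N : ℕ) (cls : List (List (ℕ × Bool))) (v v' : List (ℕ × ℕ)) : Bool :=
  !Bounded k N v || (Violates cls v || !Monotone v v')

theorem mem_descriptions {D k N : ℕ} {v : List (ℕ × ℕ)} :
    v ∈ descriptions D k N ↔ v.length = D ∧ ∀ x ∈ v, x.1 < k + 2 ∧ x.2 < N + 2 := by
  simp only [descriptions, mem_allLists, List.mem_flatMap, List.mem_range, List.mem_map,
    Prod.forall, Prod.mk.injEq, exists_eq_right_right]

theorem nodup_descriptions (D k N : ℕ) : (descriptions D k N).Nodup := by
  refine nodup_allLists D (List.nodup_flatMap.2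
    ⟨fun a _ => List.nodup_range.map fun x y h => (Prod.ext_iff.1 h).2,
      List.nodup_range.imp fun {a b} hab => ?_⟩)
  intro v hv hv'
  simp only [List.mem_map] at hv hv'
  grind

theorem conflict_eq_false {k N : ℕ} {cls : List (List (ℕ × Bool))} {v v' : List (ℕ × ℕ)} :
    Conflict k N cls v v' = false ↔
      (∀ x ∈ v, (x.1 = 0 → x.2 = 0) ∧ (x.1 = k + 1 → x.2 = N + 1)) ∧
      (¬ ∃ cl ∈ cls, ∀ p ∈ cl, (p.2 = true ∧ ∃ x ∈ v, ∃ y ∈ v, y.1 = x.1 + 1 ∧ x.2 < p.1 ∧ p.1 < y.2) ∨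
        (p.2 = false ∧ ∃ x ∈ v, x.2 = p.1)) ∧
      ∀ x ∈ v, ∀ y ∈ v', (x.1 < y.1 → x.2 < y.2) ∧ (x.1 = y.1 → x.2 = y.2) := by
  have h : ∀ a b c : Bool, (!a || (b || !c)) = false ↔ (a = true ∧ ¬ b = true ∧ c = true) := by decide
  rw [Conflict, h]
  refine and_congr ?_ (and_congr (not_congr ?_) ?_)
  · simp [Bounded, imp_iff_not_or]
  · simp only [Violates, List.any_eq_true, List.all_eq_true]
    refine exists_congr fun cl => and_congr_right fun _ => forall₂_congr fun p _ => ?_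
    cases p.2 <;> simp
  · simp [Monotone, imp_iff_not_or]

/-- The index sequences of length `D` are numbered by `finFunctionFinEquiv`, and the description of
each carries the true values of the increasing enumeration `t` of `T ∪ {0, N + 1}`. No element of
`T` lies strictly between consecutive values of `t`, so no clause appears violated. -/
theorem exists_conflictFree {k N D : ℕ} {cls : List (List (ℕ × Bool))}
    (hcls : ∀ cl ∈ cls, ∀ p ∈ cl, 1 ≤ p.1 ∧ p.1 ≤ N) (h : WSat k N cls) :
    ∃ w : Fin ((k + 2) ^ D) → List (ℕ × ℕ), w.Injective ∧ (∀ i, w i ∈ descriptions D k N) ∧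
      ∀ i i', Conflict k N cls (w i) (w i') = false := by
  obtain ⟨T, hTN, hTk, hT⟩ := h
  have h0 : 0 ∉ T := fun h => by simpa using hTN h
  have hN : N + 1 ∉ T := fun h => by simpa using hTN h
  have hcard : (insert 0 (insert (N + 1) T)).card = k + 2 := by
    rw [Finset.card_insert_of_notMem (by simp [h0]), Finset.card_insert_of_notMem hN, hTk]
  set T' : Finset ℕ := insert 0 (insert (N + 1) T) with hT'
  set t : Fin (k + 2) ↪o ℕ := T'.orderEmbOfFin hcard with ht
  have hmem (j) : t j ∈ T' := T'.orderEmbOfFin_mem hcard j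
  have hle : ∀ u ∈ T', u ≤ N + 1 := by
    intro u hu
    simp only [hT', Finset.mem_insert] at hu
    rcases hu with rfl | rfl | hu
    · omega
    · omega
    · have := Finset.mem_Icc.1 (hTN hu); omega
  have hex : ∀ u ∈ T', ∃ j, t j = u := by
    intro u hu
    have : u ∈ Set.range t := by rw [ht, Finset.range_orderEmbOfFin]; exact hu
    exact this
  have ht0 : t 0 = 0 := by
    obtain ⟨j, hj⟩ := hex 0 (by simp [hT'])
    have := t.monotone (Fin.zero_le j)
    omega
  have htl : t (Fin.last _) = N + 1 := by
    obtain ⟨j, hj⟩ := hex (N + 1) (by simp [hT'])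
    have := t.monotone (Fin.le_last j)
    have := hle _ (hmem (Fin.last _))
    omega
  have hmemT : ∀ u, 1 ≤ u → u ≤ N → (u ∈ T' ↔ u ∈ T) := by
    intro u h1 h2
    simp only [hT', Finset.mem_insert]
    constructor
    · rintro (h | h | h)
      · omega
      · omega
      · exact h
    · tauto
  have hw (i : Fin ((k + 2) ^ D)) (x : ℕ × ℕ)
      (hx : x ∈ List.ofFn fun p => (((finFunctionFinEquiv.symm i p : Fin (k + 2)) : ℕ),
        t (finFunctionFinEquiv.symm i p))) : ∃ j : Fin (k + 2), x = (↑j, t j) := by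
    obtain ⟨p, rfl⟩ := List.mem_ofFn.1 hx
    exact ⟨_, rfl⟩
  refine ⟨fun i => List.ofFn fun p => (((finFunctionFinEquiv.symm i p : Fin (k + 2)) : ℕ),
    t (finFunctionFinEquiv.symm i p)), ?_, ?_, ?_⟩
  · intro i i' h
    refine finFunctionFinEquiv.symm.injective (funext fun p => Fin.ext ?_)
    exact congrArg Prod.fst (congrFun (List.ofFn_injective h) p)
  · intro i
    refine mem_descriptions.2 ⟨List.length_ofFn, fun x hx => ?_⟩
    obtain ⟨j, rfl⟩ := hw i x hx
    have := hle _ (hmem j)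
    exact ⟨j.2, by simp only; omega⟩
  · intro i i'
    refine conflict_eq_false.2 ⟨fun x hx => ?_, ?_, fun x hx y hy => ?_⟩
    · obtain ⟨j, rfl⟩ := hw i x hx
      refine ⟨fun h => ?_, fun h => ?_⟩
      · rw [show j = 0 from Fin.ext h]; exact ht0
      · rw [show j = Fin.last _ from Fin.ext h]; exact htl
    · rintro ⟨cl, hcl, h⟩
      obtain ⟨p, hp, hpT⟩ := hT cl hcl
      obtain ⟨h1, h2⟩ := hcls cl hcl p hp
      rcases h p hp with ⟨hb, x, hx, y, hy, hxy, h3, h4⟩ | ⟨hb, x, hx, h3⟩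
      · obtain ⟨j, rfl⟩ := hw i x hx
        obtain ⟨j', rfl⟩ := hw i y hy
        obtain ⟨e, he⟩ := hex p.1 ((hmemT _ h1 h2).2 (hpT.2 hb))
        simp only [← he, t.lt_iff_lt] at hxy h3 h4
        have h3 : (j : ℕ) < e := h3
        have h4 : (e : ℕ) < j' := h4
        omega
      · obtain ⟨j, rfl⟩ := hw i x hx
        have := (hmemT _ h1 h2).1 (h3 ▸ hmem j)
        rw [hpT, hb] at this
        exact Bool.false_ne_true this
    · obtain ⟨j, rfl⟩ := hw i x hx
      obtain ⟨j', rfl⟩ := hw i' y hy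
      refine ⟨fun h => t.strictMono h, fun h => ?_⟩
      rw [show j = j' from Fin.ext h]

/-- A counting argument: absence of conflict makes the index sequences of the `w i` distinct, and
there are as many as possible, so all occur. The constant sequences define `t`, and a sequence
collecting the indices that witness a violated clause yields a contradiction. -/
theorem of_conflictFree {k N D : ℕ} {cls : List (List (ℕ × Bool))} (hD : 0 < D)
    (hlen : ∀ cl ∈ cls, 2 * cl.length ≤ D)
    (hcls : ∀ cl ∈ cls, ∀ p ∈ cl, 1 ≤ p.1 ∧ p.1 ≤ N)
    (w : Fin ((k + 2) ^ D) → List (ℕ × ℕ)) (hw : w.Injective) (hmem : ∀ i, w i ∈ descriptions D k N)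
    (hfree : ∀ i i', Conflict k N cls (w i) (w i') = false) : WSat k N cls := by
  simp only [conflict_eq_false] at hfree
  simp only [mem_descriptions] at hmem
  -- every sequence of indices is described
  have hsurj : ∀ J : Fin D → Fin (k + 2), ∃ i, ∀ p, ∃ u, ((J p : ℕ), u) ∈ w i := by
    let b (i : Fin ((k + 2) ^ D)) (p : Fin D) : Fin (k + 2) :=
      ⟨((w i)[(p : ℕ)]'(by rw [(hmem i).1]; exact p.2)).1, ((hmem i).2 _ (List.getElem_mem _)).1⟩
    -- If `w i` and `w i'` have the same indices, absence of conflict forces equal values at equal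
    -- indices, so the descriptions are equal.
    have hb : b.Injective := by
      intro i i' h
      refine hw (List.ext_getElem (by rw [(hmem i).1, (hmem i').1]) fun p h1 h2 => ?_)
      have h3 : ((w i)[p]).1 = ((w i')[p]).1 :=
        congrArg Fin.val (congrFun h ⟨p, (hmem i).1 ▸ h1⟩)
      exact Prod.ext h3 (((hfree i i').2.2 _ (List.getElem_mem h1) _ (List.getElem_mem h2)).2 h3)
    have hb' := ((Fintype.bijective_iff_injective_and_card b).2 ⟨hb, by simp⟩).2
    intro J
    obtain ⟨i, hi⟩ := hb' J
    refine ⟨i, fun p => ⟨((w i)[(p : ℕ)]'(by rw [(hmem i).1]; exact p.2)).2, ?_⟩⟩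
    rw [← hi]
    exact List.getElem_mem _
  choose I hI using fun j => hsurj fun _ => j
  choose t ht using fun j => hI j ⟨0, hD⟩
  have hval : ∀ i x, x ∈ w i → ∀ j : Fin (k + 2), x.1 = j → x.2 = t j := fun i x hx j hj =>
    ((hfree i (I j)).2.2 x hx _ (ht j)).2 hj
  have hmono : StrictMono t := fun j j' h => ((hfree (I j) (I j')).2.2 _ (ht j) _ (ht j')).1 h
  have ht0 : t 0 = 0 := ((hfree (I 0) (I 0)).1 _ (ht 0)).1 rfl
  have htl : t (Fin.last _) = N + 1 := ((hfree (I (Fin.last _)) (I 0)).1 _ (ht _)).2 rfl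
  have hT (u) : u ∈ (Finset.univ.image t) \ {0, N + 1} ↔ (∃ j, t j = u) ∧ u ≠ 0 ∧ u ≠ N + 1 := by
    simp
  refine ⟨(Finset.univ.image t) \ {0, N + 1}, fun u hu => ?_, ?_, fun cl hcl => ?_⟩
  · obtain ⟨⟨j, rfl⟩, h0, h1⟩ := (hT u).1 hu
    have := hmono.monotone (Fin.le_last j)
    rw [Finset.mem_Icc]; omega
  · rw [Finset.card_sdiff_of_subset, Finset.card_image_of_injective _ hmono.injective]
    · simp
    · intro u hu
      simp only [Finset.mem_insert, Finset.mem_singleton] at hu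
      rcases hu with rfl | rfl
      · exact Finset.mem_image.2 ⟨0, Finset.mem_univ _, ht0⟩
      · exact Finset.mem_image.2 ⟨_, Finset.mem_univ _, htl⟩
  · by_contra hviol
    push Not at hviol
    -- If `u` lay in no gap and were no value of `t`, induction on `j` would give `t j < u` for all
    -- `j`, contrary to `t (Fin.last _) = N + 1`.
    have hgap : ∀ u, 1 ≤ u → u ≤ N → u ∉ (Finset.univ.image t) \ {0, N + 1} →
        ∃ j : Fin (k + 1), t j.castSucc < u ∧ u < t j.succ := by
      intro u h1 h2 hu
      by_contra! hcon
      have : ∀ j : Fin (k + 2), t j < u := by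
        intro j
        induction j using Fin.induction with
        | zero => omega
        | succ j ih =>
          refine lt_of_le_of_ne (hcon j ih) fun h => hu ((hT u).2 ⟨⟨_, h⟩, by omega, by omega⟩)
      have := this (Fin.last _)
      omega
    -- the indices that witness the violation of a literal
    have hlit : ∀ p ∈ cl, ∃ j j' : Fin (k + 2),
        (p.2 = true ∧ (j' : ℕ) = j + 1 ∧ t j < p.1 ∧ p.1 < t j') ∨ (p.2 = false ∧ t j = p.1) := by
      intro p hp
      obtain ⟨h1, h2⟩ := hcls cl hcl p hp
      have h3 := hviol p hp
      cases hb : p.2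
      · rw [hb] at h3
        have h4 : p.1 ∈ (Finset.univ.image t) \ {0, N + 1} := by
          by_contra h; simp [h] at h3
        obtain ⟨⟨j, hj⟩, -⟩ := (hT _).1 h4
        -- The index is repeated so that every literal contributes exactly two entries to `L`.
        exact ⟨j, j, .inr ⟨rfl, hj⟩⟩
      · rw [hb] at h3
        have h4 : p.1 ∉ (Finset.univ.image t) \ {0, N + 1} := by
          intro h; simp [h] at h3
        obtain ⟨j, h5, h6⟩ := hgap _ h1 h2 h4
        exact ⟨_, _, .inl ⟨rfl, rfl, h5, h6⟩⟩
    choose! j j' hjj using hlit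
    set L := cl.flatMap fun p => [j p, j' p] with hL
    have hLlen : L.length ≤ D := by
      have : L.length = 2 * cl.length := by
        rw [hL]
        clear_value L
        induction cl with
        | nil => rfl
        | cons p cl ih => simp [List.flatMap_cons]; omega
      rw [this]; exact hlen cl hcl
    -- The witnessing indices are padded with 0 to a sequence of length `D`.
    obtain ⟨i, hi⟩ := hsurj fun p => L.getD p 0
    have hiL : ∀ e ∈ L, ((e : ℕ), t e) ∈ w i := by
      intro e he
      obtain ⟨p, hp, rfl⟩ := List.getElem_of_mem he
      obtain ⟨u, hu⟩ := hi ⟨p, hp.trans_le hLlen⟩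
      have e1 : L.getD p 0 = L[p] := by simp [hp]
      simp only [e1] at hu
      rwa [show u = _ from hval i _ hu _ rfl] at hu
    refine (hfree i i).2.1 ⟨cl, hcl, fun p hp => ?_⟩
    have m1 := hiL (j p) (List.mem_flatMap.2 ⟨p, hp, by simp⟩)
    have m2 := hiL (j' p) (List.mem_flatMap.2 ⟨p, hp, by simp⟩)
    rcases hjj p hp with ⟨hb, h1, h2, h3⟩ | ⟨hb, h1⟩
    · exact .inl ⟨hb, _, m1, _, m2, h1, h2, h3⟩
    · exact .inr ⟨hb, _, m1, h1⟩

end WSat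

/-! ### Access to list entries and enumeration of tuples in polynomial time -/

namespace PolyTime
section
variable {α β γ : Type} [Enc α] [Enc β] [Enc γ]

@[fun_prop]
theorem headD {f : γ → List α} (hf : PolyTime f) (d : α) : PolyTime fun c => (f c).headD d := by
  refine of_encode ?_
  have : PolyTime fun c => bif !(enc (f c)).toList.isEmpty then (enc (f c)).left else enc d := by
    fun_prop
  convert this using 2 with c
  cases f c <;> simp [enc_list, BTree.ofList, BTree.toList, BTree.left]

@[fun_prop]
theorem drop {f : γ → List α} {g : γ → ℕ} (hf : PolyTime f) (hg : PolyTime g) :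
    PolyTime fun c => (f c).drop (g c) := by
  have : (fun c => (f c).drop (g c)) = fun c => (List.replicate (g c) BTree.leaf).foldl
      (fun b _ => b.tail) (f c) := by
    ext1 c
    induction g c with
    | zero => simp
    | succ n ih => rw [List.replicate_succ', List.foldl_append, ← ih]; simp
  rw [this]
  refine foldl (s := fun _ b _ => b.tail) (replicate_leaf hg) hf (by fun_prop)
    ⟨0, fun c b a => ?_⟩
  cases b with
  | nil => simp
  | cons a b => rw [List.tail_cons, esize_cons]; omega

@[fun_prop]
theorem getD {f : γ → List α} {g : γ → ℕ} (hf : PolyTime f) (hg : PolyTime g) (d : α) :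
    PolyTime fun c => (f c).getD (g c) d := by
  have : PolyTime fun c => ((f c).drop (g c)).headD d := by fun_prop
  convert this using 2 with c
  simp [List.headD_eq_head?_getD, List.getD_eq_getElem?_getD]

@[fun_prop]
theorem allLists {f : γ → List α} (hf : PolyTime f) (d : ℕ) :
    PolyTime fun c => _root_.allLists d (f c) := by
  induction d with
  | zero => simp only [_root_.allLists]; fun_prop
  | succ d ih =>
    simp only [_root_.allLists]
    have : PolyTime fun p : γ × α => _root_.allLists d (f p.1) :=
      comp (f := fun c => _root_.allLists d (f c)) ih (by fun_prop)
    fun_prop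

end
end PolyTime

/-! ### From weighted satisfiability to consistency -/

namespace WSat

/-- The examples `((i, i'), -1)`, where the `i`-th and the `i'`-th description are in conflict. -/
def conflictExamples (D k N : ℕ) (cls : List (List (ℕ × Bool))) : List (List ℕ × Bool) :=
  (List.range (descriptions D k N).length).flatMap fun i =>
    (List.range (descriptions D k N).length).flatMap fun i' =>
      bif Conflict k N cls ((descriptions D k N).getD i []) ((descriptions D k N).getD i' [])
      then [([i, i'], false)] else []

/-- The instance of the consistency problem for an instance of weighted satisfiability. -/
def consistencyCode (D k N : ℕ) (cls : List (List (ℕ × Bool))) : BTree :=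
  enc ((k + 2) ^ D, ((descriptions D k N).length, (([] : List BTree),
    (conflictExamples D k N cls, MSO.pairOrCollisionCode ((k + 2) ^ D)))))

section
variable {γ : Type} [Enc γ] {k N : γ → ℕ} {cls : γ → List (List (ℕ × Bool))}
  {v v' : γ → List (ℕ × ℕ)}

@[fun_prop]
theorem polyTime_descriptions (D : ℕ) (hk : PolyTime k) (hN : PolyTime N) :
    PolyTime fun c => descriptions D (k c) (N c) := by
  unfold descriptions
  fun_prop

@[fun_prop]
theorem polyTime_bounded (hk : PolyTime k) (hN : PolyTime N) (hv : PolyTime v) :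
    PolyTime fun c => Bounded (k c) (N c) (v c) := by
  unfold Bounded
  fun_prop

@[fun_prop]
theorem polyTime_violates (hcls : PolyTime cls) (hv : PolyTime v) :
    PolyTime fun c => Violates (cls c) (v c) := by
  unfold Violates
  fun_prop

@[fun_prop]
theorem polyTime_monotone (hv : PolyTime v) (hv' : PolyTime v') :
    PolyTime fun c => Monotone (v c) (v' c) := by
  unfold Monotone
  fun_prop

@[fun_prop]
theorem polyTime_conflict (hk : PolyTime k) (hN : PolyTime N) (hcls : PolyTime cls)
    (hv : PolyTime v) (hv' : PolyTime v') :
    PolyTime fun c => Conflict (k c) (N c) (cls c) (v c) (v' c) := by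
  unfold Conflict
  fun_prop

@[fun_prop]
theorem polyTime_conflictExamples (D : ℕ) (hk : PolyTime k) (hN : PolyTime N)
    (hcls : PolyTime cls) : PolyTime fun c => conflictExamples D (k c) (N c) (cls c) := by
  unfold conflictExamples
  fun_prop

theorem polyTime_consistencyCode (D : ℕ) (hk : PolyTime k) (hN : PolyTime N)
    (hcls : PolyTime cls) : PolyTime fun c => consistencyCode D (k c) (N c) (cls c) := by
  unfold consistencyCode
  have := MSO.polyTime_pairOrCollisionCode (f := fun c => (k c + 2) ^ D) (by fun_prop)
  fun_prop

end

theorem mem_conflictExamples {D k N : ℕ} {cls : List (List (ℕ × Bool))} {e : List ℕ × Bool} :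
    e ∈ conflictExamples D k N cls ↔ ∃ i i' : Fin (descriptions D k N).length,
      Conflict k N cls (descriptions D k N)[i] (descriptions D k N)[i'] = true ∧
        e = ([(i : ℕ), (i' : ℕ)], false) := by
  simp only [conflictExamples, List.mem_flatMap, List.mem_range]
  constructor
  · rintro ⟨i, hi, i', hi', h⟩
    refine ⟨⟨i, hi⟩, ⟨i', hi'⟩, ?_⟩
    simp only [List.getD_eq_getElem?_getD, List.getElem?_eq_getElem hi, List.getElem?_eq_getElem hi',
      Option.getD_some] at h
    cases hc : Conflict k N cls (descriptions D k N)[i] (descriptions D k N)[i'] <;>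
      simp_all
  · rintro ⟨i, i', hc, rfl⟩
    refine ⟨i, i.2, i', i'.2, ?_⟩
    simp only [Fin.getElem_fin] at hc
    simp [hc]

/-- The bound on the size of the formula. -/
noncomputable def sizeBound : Polynomial ℕ :=
  ((.X + 1) + (.X + 1) + (.X * .X + 1)) * (4 * (2 + .X) + 20) + 30

theorem size_encode_le_sizeBound (l : ℕ) :
    (MSO.pairOrCollision l).encode.size ≤ sizeBound.eval l := by
  simpa [sizeBound] using MSO.size_encode_pairOrCollision l

theorem consistencyCode_mem {D k N : ℕ} {cls : List (List (ℕ × Bool))}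
    (hcls : ∀ cl ∈ cls, ∀ p ∈ cl, 1 ≤ p.1 ∧ p.1 ≤ N) (h : WSat k N cls) :
    consistencyCode D k N cls ∈ (consistencyProblem 2 0 (fun {_ l} G φ =>
      cliqueWidth G ≤ 2 ∧ G.IsAcyclic ∧ φ.encode.size ≤ sizeBound.eval l)).yes := by
  obtain ⟨w, hw, hmem, hfree⟩ := exists_conflictFree (D := D) hcls h
  choose i hi using fun j => List.getElem_of_mem (hmem j)
  choose hi hiw using hi
  have hlt : ∀ e ∈ conflictExamples D k N cls, ∀ j : Fin 2,
      e.1.getD j 0 < (descriptions D k N).length := by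
    intro e he j
    obtain ⟨i, i', -, rfl⟩ := mem_conflictExamples.1 he
    fin_cases j
    · exact i.2
    · exact i'.2
  refine ⟨(descriptions D k N).length, (k + 2) ^ D, (conflictExamples D k N cls).length, ⊥, [],
    fun e j => ⟨(conflictExamples D k N cls)[e].1.getD j 0, hlt _ (List.getElem_mem _) j⟩,
    fun e => (conflictExamples D k N cls)[e].2, MSO.pairOrCollision _, by simp,
    (MSO.qr_pairOrCollision _).le, ⟨cliqueWidth_bot_le _ ?_, SimpleGraph.isAcyclic_bot,
      size_encode_le_sizeBound _⟩, ?_, fun j => ⟨i j, hi j⟩, fun e => ?_⟩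
  -- The graph must be nonempty for its clique-width to be finite; as `(k + 2) ^ D > 0`, the
  -- solution provides a description.
  · exact (Nat.zero_le _).trans_lt (hi ⟨0, by positivity⟩)
  · have hex : (List.ofFn fun e : Fin (conflictExamples D k N cls).length =>
        BTree.node (.ofTuple fun j : Fin 2 => (⟨(conflictExamples D k N cls)[e].1.getD j 0,
          hlt _ (List.getElem_mem _) j⟩ : Fin (descriptions D k N).length))
          (.ofBool (conflictExamples D k N cls)[e].2)) =
        (conflictExamples D k N cls).map enc := by
      refine List.ext_getElem (by simp) fun e h1 h2 => ?_
      rw [List.getElem_ofFn, List.getElem_map]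
      rw [List.length_map] at h2
      obtain ⟨x, x', -, he⟩ := mem_conflictExamples.1 (List.getElem_mem h2)
      simp only [Fin.getElem_fin, he, BTree.ofTuple]
      rfl
    rw [consistencyCode, encodeInstance, hex, MSO.encode_pairOrCollision]
    rfl
  · obtain ⟨x, x', hc, he⟩ := mem_conflictExamples.1 (List.getElem_mem e.2)
    have hinj : (fun j => (⟨i j, hi j⟩ : Fin (descriptions D k N).length)).Injective := by
      intro j j' h
      have h : i j = i j' := congrArg Fin.val h
      refine hw ?_
      rw [← hiw j, ← hiw j']
      simp only [h]
    simp only [MSO.holds_pairOrCollision, hinj, not_true_eq_false, or_false, Fin.getElem_fin, he,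
      Bool.false_eq_true, iff_false, not_and]
    rintro ⟨j, hj⟩ ⟨j', hj'⟩
    have hj : i j = x := congrArg Fin.val hj
    have hj' : i j' = x' := congrArg Fin.val hj'
    have := hfree j j'
    rw [← hiw j, ← hiw j'] at this
    simp only [hj, hj'] at this
    simp only [Fin.getElem_fin, this] at hc
    exact Bool.false_ne_true hc

/-- The code determines `l`, `n`, the examples and the formula. The graph is irrelevant because the
formula has only equality atoms, so the statement holds for every `q` and every restriction `C`. -/
theorem of_consistencyCode_mem {D k N q : ℕ} {cls : List (List (ℕ × Bool))} (hD : 0 < D)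
    (hlen : ∀ cl ∈ cls, 2 * cl.length ≤ D) (hcls : ∀ cl ∈ cls, ∀ p ∈ cl, 1 ≤ p.1 ∧ p.1 ≤ N)
    {C : {n l : ℕ} → SimpleGraph (Fin n) → MSO (2 + l) 0 → Prop}
    (h : consistencyCode D k N cls ∈ (consistencyProblem 2 q C).yes) : WSat k N cls := by
  obtain ⟨n, l, m, G, E, a, σ, φ, -, -, -, heq, w, hw⟩ := h
  simp only [consistencyCode, encodeInstance, enc_prod, enc_nat, enc_tree, BTree.node.injEq,
    BTree.ofNat_injective.eq_iff] at heq
  obtain ⟨hl, hn, -, hex, hφ⟩ := heq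
  subst hl hn
  rw [← MSO.encode_pairOrCollision] at hφ
  obtain rfl := MSO.encode_injective _ _ hφ
  have hconf : ∀ i i' : Fin (descriptions D k N).length,
      Conflict k N cls (descriptions D k N)[i] (descriptions D k N)[i'] = true →
      ∃ e, a e 0 = i ∧ a e 1 = i' ∧ σ e = false := by
    intro i i' hc
    have h1 : enc (([(i : ℕ), (i' : ℕ)], false) : List ℕ × Bool) ∈
        (conflictExamples D k N cls).map enc :=
      List.mem_map_of_mem (mem_conflictExamples.2 ⟨i, i', hc, rfl⟩)
    rw [BTree.ofList_injective hex] at h1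
    obtain ⟨e, he⟩ := List.mem_ofFn.1 h1
    simp only [enc_prod, enc_list, enc_bool, BTree.node.injEq, BTree.ofTuple,
      BTree.ofList_injective.eq_iff, BTree.ofBool_injective.eq_iff, List.ofFn_succ, List.ofFn_zero,
      List.map_cons, List.map_nil, List.cons.injEq, enc_nat, BTree.ofNat_injective.eq_iff] at he
    exact ⟨e, Fin.ext he.1.1, Fin.ext he.1.2.1, he.2⟩
  simp only [MSO.holds_pairOrCollision] at hw
  have hinj : w.Injective := by
    -- The description claiming `t₀ = 1` conflicts with itself. It guarantees a negative example,
    -- without which coinciding parameters would not be excluded.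
    have h0 : List.replicate D (0, 1) ∈ descriptions D k N := by
      refine mem_descriptions.2 ⟨List.length_replicate, fun x hx => ?_⟩
      rw [List.eq_of_mem_replicate hx]
      exact ⟨by simp, by simp⟩
    obtain ⟨i, hi, hi0⟩ := List.getElem_of_mem h0
    obtain ⟨e, -, -, he⟩ := hconf ⟨i, hi⟩ ⟨i, hi⟩ (by
      rw [← Bool.not_eq_false, conflict_eq_false]
      rintro ⟨h, -⟩
      have := (h (0, 1) (by
        simp only [Fin.getElem_fin, hi0]
        exact List.mem_replicate.2 ⟨hD.ne', rfl⟩)).1 rfl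
      simp at this)
    have := (hw e).not.2 (by simp [he])
    tauto
  refine of_conflictFree hD hlen hcls (fun i => (descriptions D k N)[w i]) ?_
    (fun i => List.getElem_mem _) fun i i' => ?_
  · intro i i' h
    exact hinj (Fin.ext ((nodup_descriptions D k N).getElem_inj_iff.1 h))
  · by_contra hc
    obtain ⟨e, h1, h2, h3⟩ := hconf (w i) (w i') (by simpa using hc)
    have := (hw e).1 (.inl ⟨⟨i, h1.symm⟩, ⟨i', h2.symm⟩⟩)
    simp [h3] at this

end WSat

/-! ### Weighted definability as weighted satisfiability -/

namespace PolyTime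
section
variable {α β γ : Type} [Enc α] [Enc β] [Enc γ]

theorem constFlatMap {ι : Type*} (L : List ι) {f : γ → ι → List β}
    (hf : ∀ i, PolyTime fun c => f c i) : PolyTime fun c => L.flatMap (f c) := by
  induction L with
  | nil => simp only [List.flatMap_nil]; fun_prop
  | cons i L ih => simp only [List.flatMap_cons]; fun_prop

theorem constMap {ι : Type*} (L : List ι) {f : γ → ι → β}
    (hf : ∀ i, PolyTime fun c => f c i) : PolyTime fun c => L.map (f c) := by
  induction L with
  | nil => simp only [List.map_nil]; fun_prop
  | cons i L ih => simp only [List.map_cons]; fun_prop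

end
end PolyTime

namespace QFFormula
variable {τ : Vocab} {s d : ℕ}

/-- The value of a formula, where the relations are given by lists of tuples and the truth values of
the atoms `X v` by `β`. -/
def eval (β : (Fin s → Fin d) → Bool) (rels : List (List (List ℕ))) (a : List ℕ) :
    QFFormula τ s d → Bool
  | .eq i j => decide (a.getD i 0 = a.getD j 0)
  | .rel R v => (rels.getD R []).any fun t =>
      (List.ofFn fun i => ((i : ℕ), (v i : ℕ))).all fun p => decide (t.getD p.1 0 = a.getD p.2 0)
  | .var v => β v
  | .neg ψ => !ψ.eval β rels a
  | .conj ψ χ => ψ.eval β rels a && χ.eval β rels a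
  | .disj ψ χ => ψ.eval β rels a || χ.eval β rels a

@[fun_prop]
theorem polyTime_eval (β : (Fin s → Fin d) → Bool) (ψ : QFFormula τ s d) {γ : Type} [Enc γ]
    {rels : γ → List (List (List ℕ))} {a : γ → List ℕ} (hr : PolyTime rels) (ha : PolyTime a) :
    PolyTime fun c => ψ.eval β (rels c) (a c) := by
  induction ψ with
  | eq i j => simp only [eval]; fun_prop
  | rel R v => simp only [eval]; fun_prop
  | var v => simp only [eval]; fun_prop
  | neg ψ ih => simp only [eval]; fun_prop
  | conj ψ χ ih ih' => simp only [eval]; fun_prop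
  | disj ψ χ ih ih' => simp only [eval]; fun_prop

/-- The tuple as a list of numbers. -/
def natList {m n : ℕ} (t : Fin m → Fin n) : List ℕ := List.ofFn fun i => (t i : ℕ)

theorem getD_natList {m n : ℕ} (t : Fin m → Fin n) (i : Fin m) : (natList t).getD i 0 = t i := by
  simp [natList]

/-- The assignment `β` decouples the atoms `X v` from the structure: all other atoms are evaluated
by the reduction, and only those of `X` remain unknown. -/
theorem eval_eq_true_iff {n : ℕ} {A : RelStr τ (Fin n)}
    {L : (R : Fin τ.num) → List (Fin (τ.arity R) → Fin n)} (hL : ∀ R t, t ∈ L R ↔ t ∈ A.rel R)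
    {rels : List (List (List ℕ))} (hrels : ∀ R : Fin τ.num, rels.getD R [] = (L R).map natList)
    {β : (Fin s → Fin d) → Bool} {S : Set (Fin s → Fin n)} {a : Fin d → Fin n}
    (hβ : ∀ v, β v = true ↔ (fun i => a (v i)) ∈ S) (ψ : QFFormula τ s d) :
    ψ.eval β rels (natList a) = true ↔ ψ.Holds A S a := by
  induction ψ with
  | eq i j => simp only [eval, Holds, getD_natList, decide_eq_true_eq, Fin.ext_iff]
  | rel R v =>
    simp only [eval, Holds, hrels, ← hL, List.any_eq_true, List.all_eq_true, List.mem_map,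
      List.mem_ofFn, decide_eq_true_eq]
    constructor
    · rintro ⟨_, ⟨t, ht, rfl⟩, h⟩
      convert ht with i
      have := h _ ⟨i, rfl⟩
      simp only [getD_natList] at this
      exact (Fin.ext this).symm
    · intro h
      refine ⟨_, ⟨_, h, rfl⟩, ?_⟩
      rintro _ ⟨i, rfl⟩
      simp only [getD_natList]
  | var v => exact hβ v
  | neg ψ ih => simp only [eval, Holds, ← ih, Bool.not_eq_true', Bool.not_eq_true]
  | conj ψ χ ih ih' => simp only [eval, Holds, ← ih, ← ih', Bool.and_eq_true]
  | disj ψ χ ih ih' => simp only [eval, Holds, ← ih, ← ih', Bool.or_eq_true]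

/-- The number of the propositional variable for the atom `X v` under the assignment `a`. -/
def varIndex (n : ℕ) (a : List ℕ) (v : Fin s → Fin d) : ℕ :=
  (∑ i, a.getD (v i) 0 * n ^ (i : ℕ)) + 1

/-- The clause that excludes the truth values `β` of the atoms under the assignment `a`. -/
noncomputable def clause (n : ℕ) (a : List ℕ) (β : (Fin s → Fin d) → Bool) : List (ℕ × Bool) :=
  (Finset.univ : Finset (Fin s → Fin d)).toList.map fun v => (varIndex n a v, !β v)

/-- The clauses for all assignments and all truth values of the atoms that falsify the formula. -/
noncomputable def clauses (ψ : QFFormula τ s d) (n : ℕ) (rels : List (List (List ℕ))) :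
    List (List (ℕ × Bool)) :=
  (Finset.univ : Finset ((Fin s → Fin d) → Bool)).toList.flatMap fun β =>
    (allLists d (List.range n)).flatMap fun a =>
      bif ψ.eval β rels a then [] else [clause n a β]

theorem polyTime_clauses (ψ : QFFormula τ s d) {γ : Type} [Enc γ] {n : γ → ℕ}
    {rels : γ → List (List (List ℕ))} (hn : PolyTime n) (hr : PolyTime rels) :
    PolyTime fun c => ψ.clauses (n c) (rels c) := by
  unfold clauses
  refine PolyTime.constFlatMap _ fun β => ?_
  have : PolyTime fun p : γ × List ℕ => clause (n p.1) p.2 β := by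
    unfold clause
    refine PolyTime.constMap _ fun v => ?_
    unfold varIndex
    have := PolyTime.finset_sum Finset.univ (f := fun (p : γ × List ℕ) (i : Fin s) =>
      p.2.getD (v i) 0 * n p.1 ^ (i : ℕ)) fun i => by fun_prop
    fun_prop
  fun_prop

theorem length_clause {n : ℕ} {a : List ℕ} {β : (Fin s → Fin d) → Bool} :
    (clause n a β).length = Fintype.card (Fin s → Fin d) := by
  simp [clause]

theorem mem_clauses {ψ : QFFormula τ s d} {n : ℕ} {rels : List (List (List ℕ))}
    {cl : List (ℕ × Bool)} : cl ∈ ψ.clauses n rels ↔ ∃ (β : (Fin s → Fin d) → Bool)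
      (a : Fin d → Fin n), ψ.eval β rels (natList a) = false ∧ cl = clause n (natList a) β := by
  simp only [clauses, List.mem_flatMap, Finset.mem_toList, Finset.mem_univ, true_and, mem_allLists,
    List.mem_range]
  refine exists_congr fun β => ⟨?_, ?_⟩
  · rintro ⟨a, ⟨rfl, ha⟩, h⟩
    have hna : natList (fun i : Fin a.length => (⟨a[i], ha _ (List.getElem_mem _)⟩ : Fin n)) = a :=
      List.ofFn_getElem
    refine ⟨fun i => ⟨a[i], ha _ (List.getElem_mem _)⟩, ?_⟩
    rw [hna]
    cases hc : ψ.eval β rels a <;> simp_all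
  · rintro ⟨a, h, rfl⟩
    refine ⟨natList a, ⟨List.length_ofFn, fun x hx => ?_⟩, by simp [h]⟩
    obtain ⟨i, rfl⟩ := List.mem_ofFn.1 hx
    exact (a i).2

/-- The propositional variable for a tuple. -/
def tupleVar (s n : ℕ) : (Fin s → Fin n) ↪ ℕ :=
  ⟨fun t => finFunctionFinEquiv t + 1, fun _ _ h => finFunctionFinEquiv.injective
    (Fin.ext (Nat.succ_injective h))⟩

theorem tupleVar_apply {n : ℕ} (t : Fin s → Fin n) : tupleVar s n t = finFunctionFinEquiv t + 1 :=
  rfl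

theorem varIndex_natList {n : ℕ} (a : Fin d → Fin n) (v : Fin s → Fin d) :
    varIndex n (natList a) v = tupleVar s n fun i => a (v i) := by
  simp only [varIndex, tupleVar, getD_natList, Function.Embedding.coeFn_mk,
    finFunctionFinEquiv_apply]

theorem mem_Icc_iff_exists_tupleVar {s n u : ℕ} :
    u ∈ Finset.Icc 1 (n ^ s) ↔ ∃ t, tupleVar s n t = u := by
  rw [Finset.mem_Icc]
  constructor
  · rintro ⟨h1, h2⟩
    refine ⟨finFunctionFinEquiv.symm ⟨u - 1, by omega⟩, ?_⟩
    rw [tupleVar_apply, Equiv.apply_symm_apply]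
    exact Nat.sub_add_cancel h1
  · rintro ⟨t, rfl⟩
    rw [tupleVar_apply]
    exact ⟨Nat.succ_pos _, (finFunctionFinEquiv t).2⟩

theorem mem_clause_bounds {n : ℕ} {ψ : QFFormula τ s d} {rels : List (List (List ℕ))} :
    ∀ cl ∈ ψ.clauses n rels, ∀ p ∈ cl, 1 ≤ p.1 ∧ p.1 ≤ n ^ s := by
  intro cl hcl p hp
  obtain ⟨β, a, -, rfl⟩ := mem_clauses.1 hcl
  obtain ⟨v, -, rfl⟩ := List.mem_map.1 hp
  rw [varIndex_natList]
  exact Finset.mem_Icc.1 (mem_Icc_iff_exists_tupleVar.2 ⟨_, rfl⟩)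

/-- A set of tuples corresponds to the set of their variables. Under an assignment `a` it induces
truth values `β` of the atoms `X v`, and the clause for `a` and `β` is violated exactly by the sets
inducing `β`. If two atoms denote the same tuple and `β` disagrees on them, the clause is a
tautology, so such `β` do no harm. -/
theorem wsat_clauses_iff {k n : ℕ} {A : RelStr τ (Fin n)}
    {L : (R : Fin τ.num) → List (Fin (τ.arity R) → Fin n)} (hL : ∀ R t, t ∈ L R ↔ t ∈ A.rel R)
    {rels : List (List (List ℕ))} (hrels : ∀ R : Fin τ.num, rels.getD R [] = (L R).map natList)
    (ψ : QFFormula τ s d) :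
    WSat k (n ^ s) (ψ.clauses n rels) ↔
      ∃ S : Finset (Fin s → Fin n), S.card = k ∧ ∀ a : Fin d → Fin n, ψ.Holds A (S : Set _) a := by
  have hsat (T : Finset ℕ) (β : (Fin s → Fin d) → Bool) (a : Fin d → Fin n) :
      (∃ p ∈ clause n (natList a) β, (p.1 ∈ T ↔ p.2 = true)) ↔
        ¬ ∀ v, (β v = true ↔ tupleVar s n (fun i => a (v i)) ∈ T) := by
    simp only [clause, List.mem_map, Finset.mem_toList, Finset.mem_univ, true_and,
      exists_exists_eq_and, varIndex_natList, not_forall]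
    refine exists_congr fun v => ?_
    cases β v <;> simp
  constructor
  · rintro ⟨T, hTN, hTk, hT⟩
    classical
    refine ⟨Finset.univ.filter fun t => tupleVar s n t ∈ T, ?_, fun a => ?_⟩
    · rw [← hTk, ← Finset.card_map (tupleVar s n)]
      congr 1
      ext u
      simp only [Finset.mem_map, Finset.mem_filter, Finset.mem_univ, true_and]
      constructor
      · rintro ⟨t, ht, rfl⟩
        exact ht
      · intro hu
        obtain ⟨t, rfl⟩ := mem_Icc_iff_exists_tupleVar.1 (hTN hu)
        exact ⟨t, hu, rfl⟩
    · by_contra hh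
      have hβ : ∀ v : Fin s → Fin d, decide (tupleVar s n (fun i => a (v i)) ∈ T) = true ↔
          tupleVar s n (fun i => a (v i)) ∈ T := fun v => decide_eq_true_iff
      rw [← eval_eq_true_iff hL hrels (S := _) (β := fun v => decide
        (tupleVar s n (fun i => a (v i)) ∈ T)) (by simp), Bool.not_eq_true] at hh
      exact (hsat T _ a).1 (hT _ (mem_clauses.2 ⟨_, a, hh, rfl⟩)) hβ
  · rintro ⟨S, hSk, hS⟩
    refine ⟨S.map (tupleVar s n), fun u hu => ?_, by rw [Finset.card_map, hSk], fun cl hcl => ?_⟩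
    · obtain ⟨t, -, rfl⟩ := Finset.mem_map.1 hu
      exact mem_Icc_iff_exists_tupleVar.2 ⟨t, rfl⟩
    · obtain ⟨β, a, h, rfl⟩ := mem_clauses.1 hcl
      rw [hsat]
      intro hβ
      simp only [Finset.mem_map'] at hβ
      have := (eval_eq_true_iff hL hrels (S := (S : Set _)) hβ ψ).2 (hS a)
      rw [this] at h
      exact Bool.false_ne_true h.symm

end QFFormula

/-! ### Reading instances of the weighted definability problem -/

namespace BTree

/-- The tree encodes a number. -/
def IsNumeral (x : BTree) : Bool := x.toList.all fun y => !(!y.toList.isEmpty)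

theorem isNumeral_iff {x : BTree} : IsNumeral x = true ↔ ofNat x.spine = x := by
  induction x with
  | leaf => simp [IsNumeral, toList, ofNat, spine]
  | node l r _ ih =>
    simp only [IsNumeral, toList, List.all_cons, spine, ofNat, node.injEq, Bool.and_eq_true] at ih ⊢
    rw [← ih]
    refine and_congr_left fun _ => ?_
    cases l <;> simp [toList]

@[fun_prop]
theorem polyTime_isNumeral {γ : Type} [Enc γ] {f : γ → BTree} (hf : PolyTime f) :
    PolyTime fun c => IsNumeral (f c) := by
  unfold IsNumeral
  fun_prop

end BTree

/-- The encoding of an instance of the weighted definability problem. -/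
def structureCode {τ : Vocab} (k n : ℕ) (L : (R : Fin τ.num) → List (Fin (τ.arity R) → Fin n)) :
    BTree :=
  .node (.ofNat k) (.node (.ofNat n) (.ofList (List.ofFn fun R => .ofList ((L R).map .ofTuple))))

/-- The tree encodes an instance of the weighted definability problem. -/
def IsStructureCode (τ : Vocab) (x : BTree) : Bool :=
  x.left.IsNumeral && (x.right.left.IsNumeral && (!x.right.left.toList.isEmpty &&
    (decide (x.right.right.toList.length = τ.num) &&
      (List.ofFn fun R : Fin τ.num => ((R : ℕ), τ.arity R)).all fun p =>
        (x.right.right.toList.getD p.1 .leaf).toList.all fun t =>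
          decide (t.toList.length = p.2) &&
            t.toList.all fun e => e.IsNumeral && decide (e.spine < x.right.left.spine))))

/-- The lists of tuples of the relations. -/
def relationLists (x : BTree) : List (List (List ℕ)) :=
  x.right.right.toList.map fun q => q.toList.map fun t => t.toList.map fun e => e.spine

theorem ofTuple_toList {m n : ℕ} (t : Fin m → Fin n) :
    (BTree.ofTuple t).toList = List.ofFn fun i => BTree.ofNat (t i) := by
  simp [BTree.ofTuple]

theorem isStructureCode_iff {τ : Vocab} {x : BTree} : IsStructureCode τ x = true ↔
    ∃ (k n : ℕ) (L : (R : Fin τ.num) → List (Fin (τ.arity R) → Fin n)),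
      0 < n ∧ x = structureCode k n L := by
  constructor
  · intro h
    simp only [IsStructureCode, Bool.and_eq_true, BTree.isNumeral_iff, decide_eq_true_eq,
      List.all_eq_true, List.mem_ofFn, forall_exists_index, forall_apply_eq_imp_iff] at h
    obtain ⟨hk, hn, hn0, hlen, h⟩ := h
    have hpos : 0 < x.right.left.spine := by
      rcases hx : x.right.left with _ | _
      · simp [hx, BTree.toList] at hn0
      · simp [BTree.spine]
    -- Reduction modulo the size of the universe only provides elements of `Fin n`; the entries were
    -- checked to be smaller, so it changes nothing.
    refine ⟨x.left.spine, x.right.left.spine, fun R =>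
      (x.right.right.toList.getD R .leaf).toList.map fun t i =>
        ⟨(t.toList.getD i .leaf).spine % x.right.left.spine, Nat.mod_lt _ hpos⟩, hpos, ?_⟩
    have hrel : x.right.right = BTree.ofList (List.ofFn fun R : Fin τ.num =>
        x.right.right.toList.getD R .leaf) := by
      conv_lhs => rw [← BTree.ofList_toList x.right.right]
      congr 1
      exact List.ext_getElem (by simpa using hlen) fun i h1 h2 => by simp [h1]
    have htup : ∀ R : Fin τ.num, BTree.ofList (((x.right.right.toList.getD R .leaf).toList.map
        fun t (i : Fin (τ.arity R)) => (⟨(t.toList.getD i .leaf).spine % x.right.left.spine,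
          Nat.mod_lt _ hpos⟩ : Fin x.right.left.spine)).map .ofTuple) =
        x.right.right.toList.getD R .leaf := by
      intro R
      conv_rhs => rw [← BTree.ofList_toList (x.right.right.toList.getD R .leaf)]
      congr 1
      rw [List.map_map]
      refine (List.map_congr_left fun t ht => ?_).trans (List.map_id _)
      obtain ⟨h1, h2⟩ := h R t ht
      simp only [Function.comp_apply, id]
      conv_rhs => rw [← BTree.ofList_toList t]
      rw [BTree.ofTuple]
      congr 1
      refine List.ext_getElem (by simp [h1]) fun i h3 h4 => ?_
      obtain ⟨h5, h6⟩ := h2 _ (List.getElem_mem h4)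
      simp [h4, Nat.mod_eq_of_lt h6, h5]
    rw [structureCode]
    simp only [htup, ← hrel, hk, hn]
    rcases x with _ | ⟨l, _ | ⟨r, r'⟩⟩
    · simp [BTree.right, BTree.left, BTree.spine] at hpos
    · simp [BTree.right, BTree.left, BTree.spine] at hpos
    · rfl
  · rintro ⟨k, n, L, hn, rfl⟩
    simp only [IsStructureCode, structureCode, BTree.left, BTree.right, Bool.and_eq_true,
      BTree.isNumeral_iff, decide_eq_true_eq, List.all_eq_true, List.mem_ofFn, forall_exists_index,
      forall_apply_eq_imp_iff, BTree.spine_ofNat, BTree.toList_ofList, List.length_ofFn, true_and]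
    refine ⟨?_, fun R t ht => ?_⟩
    · obtain ⟨n, rfl⟩ := Nat.exists_eq_succ_of_ne_zero hn.ne'
      simp [BTree.ofNat, BTree.toList]
    · simp only [List.getD_eq_getElem?_getD, List.getElem?_ofFn, R.2, dite_true,
        Option.getD_some, BTree.toList_ofList, List.mem_map] at ht
      obtain ⟨t, -, rfl⟩ := ht
      rw [ofTuple_toList]
      refine ⟨List.length_ofFn, fun e he => ?_⟩
      obtain ⟨i, rfl⟩ := List.mem_ofFn.1 he
      simp

theorem relationLists_structureCode {τ : Vocab} (k n : ℕ)
    (L : (R : Fin τ.num) → List (Fin (τ.arity R) → Fin n)) (R : Fin τ.num) :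
    (relationLists (structureCode k n L)).getD R [] = (L R).map QFFormula.natList := by
  have h : ∀ t : Fin (τ.arity R) → Fin n,
      ((BTree.ofTuple t).toList.map fun e => e.spine) = QFFormula.natList t := fun t => by
    rw [ofTuple_toList, List.map_ofFn, QFFormula.natList]
    simp [Function.comp_def]
  simp [relationLists, structureCode, BTree.right, ← h, Function.comp_def]

/-! ### The reduction -/

/-- The reduction from the weighted definability problem to the consistency problem. -/
noncomputable def consistencyReduction {τ : Vocab} {s d : ℕ} (ψ : QFFormula τ s d) (x : BTree) :
    BTree :=
  bif IsStructureCode τ x then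
    WSat.consistencyCode (2 * Fintype.card (Fin s → Fin d) + 1) x.left.spine
      (x.right.left.spine ^ s) (ψ.clauses x.right.left.spine (relationLists x))
  else .leaf

theorem polyTime_consistencyReduction {τ : Vocab} {s d : ℕ} (ψ : QFFormula τ s d) :
    PolyTime (consistencyReduction ψ) := by
  have h1 : PolyTime fun x => IsStructureCode τ x := by
    unfold IsStructureCode
    fun_prop
  have h2 : PolyTime relationLists := by
    unfold relationLists
    fun_prop
  have h3 := ψ.polyTime_clauses (n := fun x : BTree => x.right.left.spine) (by fun_prop) h2
  exact .cond h1 (WSat.polyTime_consistencyCode _ (by fun_prop) (by fun_prop) h3) (.const _)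

theorem consistencyReduction_structureCode {τ : Vocab} {s d k n : ℕ} (ψ : QFFormula τ s d)
    (hn : 0 < n) (L : (R : Fin τ.num) → List (Fin (τ.arity R) → Fin n)) :
    consistencyReduction ψ (structureCode k n L) =
      WSat.consistencyCode (2 * Fintype.card (Fin s → Fin d) + 1) k (n ^ s)
        (ψ.clauses n (relationLists (structureCode k n L))) := by
  rw [consistencyReduction, isStructureCode_iff.2 ⟨k, n, L, hn, rfl⟩, cond_true]
  simp [structureCode, BTree.left, BTree.right]

theorem consistencyReduction_mem {τ : Vocab} {s d : ℕ} {ψ : QFFormula τ s d} {x : BTree}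
    (hx : x ∈ (weightedDefinability ψ).yes) :
    consistencyReduction ψ x ∈ (consistencyProblem 2 0 (fun {_ l} G φ =>
      cliqueWidth G ≤ 2 ∧ G.IsAcyclic ∧ φ.encode.size ≤ WSat.sizeBound.eval l)).yes := by
  obtain ⟨k, n, A, L, hn, hL, hx, hS⟩ := hx
  obtain rfl : x = structureCode k n L := hx
  rw [consistencyReduction_structureCode ψ hn]
  exact WSat.consistencyCode_mem QFFormula.mem_clause_bounds
    ((ψ.wsat_clauses_iff hL (relationLists_structureCode k n L)).2 hS)

theorem of_consistencyReduction_mem {τ : Vocab} {s d q : ℕ} {ψ : QFFormula τ s d} {x : BTree}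
    {C : {n l : ℕ} → SimpleGraph (Fin n) → MSO (2 + l) 0 → Prop}
    (hx : consistencyReduction ψ x ∈ (consistencyProblem 2 q C).yes) :
    x ∈ (weightedDefinability ψ).yes := by
  cases hc : IsStructureCode τ x
  · rw [consistencyReduction, hc, cond_false] at hx
    obtain ⟨n, l, m, G, E, a, σ, φ, -, -, -, h, -⟩ := hx
    -- A tree that is not an instance is sent to `leaf`, which encodes no instance of the
    -- consistency problem.
    simp [encodeInstance] at h
  · obtain ⟨k, n, L, hn, rfl⟩ := isStructureCode_iff.1 hc
    rw [consistencyReduction_structureCode ψ hn] at hx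
    have hL : ∀ R t, t ∈ L R ↔ t ∈ (⟨fun R => {t | t ∈ L R}⟩ : RelStr τ (Fin n)).rel R :=
      fun _ _ => Iff.rfl
    refine ⟨k, n, _, L, hn, hL, rfl, (ψ.wsat_clauses_iff hL (relationLists_structureCode k n L)).1
      (WSat.of_consistencyCode_mem (Nat.succ_pos _) (fun cl hcl => ?_)
        QFFormula.mem_clause_bounds hx)⟩
    obtain ⟨β, a, -, rfl⟩ := QFFormula.mem_clauses.1 hcl
    rw [QFFormula.length_clause]
    omega

theorem spine_left_consistencyReduction_le {τ : Vocab} {s d : ℕ} (ψ : QFFormula τ s d) (x : BTree) :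
    (consistencyReduction ψ x).left.spine ≤
      (x.left.spine + 2) ^ (2 * Fintype.card (Fin s → Fin d) + 1) := by
  cases hc : IsStructureCode τ x
  · simp [consistencyReduction, hc, BTree.left, BTree.spine]
  · simp [consistencyReduction, hc, WSat.consistencyCode, enc_prod, BTree.left, enc_nat]

/-- Yes-instances are mapped to instances meeting the strongest restriction, hence `C`; a
yes-instance of the target leads back to a yes-instance whatever `C` is. So the same reduction works
for every `C` that admits these instances. -/
theorem w1Hard_consistencyProblem {C : {n l : ℕ} → SimpleGraph (Fin n) → MSO (2 + l) 0 → Prop}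
    (hC : ∀ {n l : ℕ} (G : SimpleGraph (Fin n)) (φ : MSO (2 + l) 0), cliqueWidth G ≤ 2 →
      G.IsAcyclic → φ.encode.size ≤ WSat.sizeBound.eval l → C G φ) :
    W1Hard (consistencyProblem 2 0 C) := by
  rintro A ⟨τ, s, d, ψ, hA⟩
  refine hA.trans_polyTime (polyTime_consistencyReduction ψ)
    (fun x => ⟨fun hx => ?_, of_consistencyReduction_mem⟩)
    ((.X + 2) ^ (2 * Fintype.card (Fin s → Fin d) + 1)) fun x => ?_
  · obtain ⟨n, l, m, G, E, a, σ, φ, hG, hq, ⟨h1, h2, h3⟩, h⟩ := consistencyReduction_mem hx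
    exact ⟨n, l, m, G, E, a, σ, φ, hG, hq, hC G φ h1 h2 h3, h⟩
  · rw [Polynomial.eval_pow, Polynomial.eval_add, Polynomial.eval_X, Polynomial.eval_ofNat]
    exact spine_left_consistencyReduction_le ψ x

theorem theorem7p1 :
    ∃ q : ℕ,
      W1Hard (consistencyProblem 2 q (fun G _ => cliqueWidth G ≤ 2)) ∧
      ∃ h : ℕ → ℕ, Computable h ∧
        W1Hard (consistencyProblem 2 q (fun {_ l} G φ =>
          cliqueWidth G ≤ 2 ∧ G.IsAcyclic ∧ φ.encode.size ≤ h l)) :=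
  ⟨0, w1Hard_consistencyProblem fun _ _ h _ _ => h, fun l => WSat.sizeBound.eval l,
    WSat.sizeBound.computable_eval, w1Hard_consistencyProblem fun _ _ h1 h2 h3 => ⟨h1, h2, h3⟩⟩
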